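/- **Proposition (Hitting time of two-phased zero-range configurations).** *Process.* For $K\ge1$ let $\mathbb T_K=\mathbb Z/K\mathbb Z$. The facilitated zero-range process on $\mathbb T_K$ is the continuous-time Markov chain on $\mathbb N^{\mathbb T_K}$ ($\mathbb N=\{0,1,2,\dots\}$) with generator $$\mathcal L_K f(\omega)=\sum_{x\in\mathbb T_K}\sum_{\delta=\pm1}\mathbf 1_{\{\omega_x\ge2\}}\big(f(\omega^{x,x+\delta})-f(\omega)\big),$$ where $\omega^{x,y}$ is $\omega$ with one particle moved from $x$ to $y$. Let $\mathcal Q_{K,\bar\omega}$ be its law when started from the fixed configuration $\bar\omega$. *Profile.* Let $\rho:\mathbb T=\mathbb R/\mathbb Z\to[0,1)$ be of class $C^2$, and assume that for some $u_*\in(0,1)$ one has $\rho^{-1}(\{\tfrac12\})=\{0,u_*\}$ and $\rho^{-1}([0,\tfrac12])=[0,u_*]$, and that $\rho'(0)\ne0$, $\rho'(u_*)\neq0$. Put $v(u)=\int_0^u(1-\rho(s))\,ds$, $\bar v=v(1)$, $v_*=v(u_*)$, $c_*=4\bar v\min\{-\rho'(0),\rho'(u_*)\}>0$. *Typical configurations.*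 Let $\ell_K=\lfloor K^{3/4}\rfloor$, $k_*=\lfloor Kv_*/\bar v\rfloor$, $\alpha_K=1+c_*\ell_K/K$, $\Lambda_K^+=\{1,\dots,10\ell_K\}$, $\mathbf B_K=\{\ell_K,\dots,k_*-\ell_K\}$ and $\mathbf A_K=\mathbb T_K\setminus\mathbf B_K$. Let $\Omega_K^+$ be the set of $\omega\in\mathbb N^{\mathbb T_K}$ which vanish outside $\Lambda_K^+$ and satisfy $\sum_{x\in\Lambda_K^+}\omega_x=\lfloor\alpha_K|\Lambda_K^+|\rfloor$ and $\sum_{x\in\Lambda_K^+}\omega_x(x-5\ell_K)\le0$; let $\Omega_K^-$ be the set of $\omega$ whose reflection $x\mapsto\omega_{-x}$ belongs to $\Omega_K^+$. The set $\mathcal T_K$ of typical configurations consists of all $\omega\in\mathbb N^{\mathbb T_K}$ such that 1. every connected $\Lambda\subset\mathbf B_K$ with $|\Lambda|\ge\ell_K$ satisfies $\frac1{|\Lambda|}\sum_{x\in\Lambda}\omega_x\le1$; 2. for every $x\in\mathbf A_K$ there is $\omega'\in\Omega_K^+\cup\Omega_K^-$ such that $\omega_y\ge\omega'_{y-x}$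 for all $y\in\mathbb T_K$. *Two-phased configurations.* A configuration $\omega\in\mathbb N^{\mathbb T_K}$ is two-phased if there is a partition $\mathbb T_K=A\sqcup B$ into two (possibly empty) connected subsets of $\mathbb T_K$ with $\omega_x\ge1$ for all $x\in A$ and $\omega_x\le1$ for all $x\in B$. Let $\mathfrak P_K$ be the set of such configurations. *Claim.* Let $T_K=K^{7/4}$ and $\mathcal G_K=\{\forall x\in\mathbb T_K,\ \forall t\in[0,T_K]:\ \omega_x(t)<\log^2K\}$. Then $$\lim_{K\to\infty}\ \sup_{\bar\omega\in\mathcal T_K}\mathcal Q_{K,\bar\omega}\Big(\mathcal G_K\cap\{\omega(T_K)\notin\mathfrak P_K\}\Big)=0 .$$ In other words, with probability tending to $1$ uniformly over typical initial configurations, either some site carries at least $\log^2K$ particles at some time $t\le T_K$, or the configuration at time $T_K$ is two-phased. -/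

import Mathlib

open MeasureTheory ProbabilityTheory Filter Topology
open scoped ENNReal

noncomputable section

namespace FacilitatedZR

/-! ### Configurations, generator and law of the facilitated zero-range process -/

/-- Particle configurations on the discrete torus `ℤ/Kℤ`. -/
abbrev Config (K : ℕ) : Type := ZMod K → ℕ

/-- The configuration `ω^{x,y}`, where one particle of `ω` is moved from `x` to `y`. -/
def moveParticle {K : ℕ} (ω : Config K) (x y : ZMod K) : Config K :=
  fun z => if z = x then ω x - 1 else if z = y then ω y + 1 else ω z

/-- The neighbour `x + δ` of the site `x`, where `δ = ±1` (the units of `ℤ`). -/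
def neighbour {K : ℕ} (x : ZMod K) (δ : ℤˣ) : ZMod K := x + (((δ : ℤ)) : ZMod K)

/-- The (non-accelerated) generator of the facilitated zero-range process:
`L f (ω) = ∑_x ∑_{δ = ±1} 1_{ω_x ≥ 2} (f (ω^{x,x+δ}) - f ω)`. -/
def zrGenerator (K : ℕ) [NeZero K] (f : Config K → ℝ) (ω : Config K) : ℝ :=
  ∑ x : ZMod K, ∑ δ : ℤˣ,
    if 2 ≤ ω x then f (moveParticle ω x (neighbour x δ)) - f ω else 0

/-- Effect on `ω` of a ring of the clock `(x, δ)`: if there are at least two particles at `x`,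
one of them jumps to `x + δ`; otherwise nothing happens. -/
def ring {K : ℕ} (ω : Config K) (m : ZMod K × ℤˣ) : Config K :=
  if 2 ≤ ω m.1 then moveParticle ω m.1 (neighbour m.1 m.2) else ω

/-- The uniform law on the `2K` clocks `(x, δ)`. -/
def clockChoice (K : ℕ) [NeZero K] : Measure (ZMod K × ℤˣ) :=
  (PMF.uniformOfFintype (ZMod K × ℤˣ)).toMeasure

/-- Randomness driving the process: an i.i.d. sequence of (waiting time, clock) pairs, the waiting
times being exponential of rate `2K` and the clocks independent of them and uniform.
Equivalently, each of the `2K` clocks `(x, δ)` rings according to an independent Poisson process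
of rate `1`. -/
def clockMeasure (K : ℕ) [NeZero K] : Measure (ℕ → ℝ × (ZMod K × ℤˣ)) :=
  Measure.infinitePi fun _ : ℕ => (expMeasure (2 * (K : ℝ))).prod (clockChoice K)

/-- The number of rings up to time `t` (the `n`-th ring, `n ≥ 0`, takes place at the sum of the
first `n + 1` waiting times). -/
def ringCount {K : ℕ} (ξ : ℕ → ℝ × (ZMod K × ℤˣ)) (t : ℝ) : ℕ :=
  Set.ncard {n : ℕ | ∑ i ∈ Finset.range (n + 1), (ξ i).1 ≤ t}

/-- The configuration after the first `n` rings, started from `ω₀`. -/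
def configAfter {K : ℕ} (ω₀ : Config K) (ξ : ℕ → ℝ × (ZMod K × ℤˣ)) : ℕ → Config K
  | 0 => ω₀
  | n + 1 => ring (configAfter ω₀ ξ n) (ξ n).2

/-- The trajectory `t ↦ ω(t)`, `t ≥ 0`, of the facilitated zero-range process started from `ω₀`. -/
def zrPath {K : ℕ} (ω₀ : Config K) (ξ : ℕ → ℝ × (ZMod K × ℤˣ)) (t : ℝ) : Config K :=
  configAfter ω₀ ξ (ringCount ξ t)

/-- `zrProb K ω₀ E` is the probability that the trajectory of the facilitated zero-range process
on `ℤ/Kℤ` started from the fixed configuration `ω₀` belongs to the set of trajectories `E`. -/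
def zrProb (K : ℕ) [NeZero K] (ω₀ : Config K) (E : Set (ℝ → Config K)) : ℝ≥0∞ :=
  clockMeasure K {ξ | zrPath ω₀ ξ ∈ E}

/-- The construction above is driven by `zrGenerator`: rings occur at total rate `2K`, and `2K`
times the mean variation of `f` at a ring is `zrGenerator K f`. -/
theorem zrGenerator_eq_ring (K : ℕ) [NeZero K] (f : Config K → ℝ) (ω : Config K) :
    zrGenerator K f ω = 2 * (K : ℝ) * ∫ m, (f (ring ω m) - f ω) ∂(clockChoice K) := by
  have hK : (K : ℝ) ≠ 0 := Nat.cast_ne_zero.2 (NeZero.ne K)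
  have hm : MeasurableSingletonClass ℤˣ := ⟨fun δ =>
    ⟨{(δ : ℤ)}, measurableSet_singleton _, by ext ε; simp [Units.ext_iff]⟩⟩
  unfold clockChoice
  rw [PMF.integral_eq_sum, Fintype.sum_prod_type, Finset.mul_sum]
  unfold zrGenerator
  refine Finset.sum_congr rfl fun x _ => ?_
  rw [Finset.mul_sum]
  refine Finset.sum_congr rfl fun δ _ => ?_
  have hc : Fintype.card (ZMod K × ℤˣ) = K * 2 := by
    rw [Fintype.card_prod, ZMod.card]; rfl
  have e : ((PMF.uniformOfFintype (ZMod K × ℤˣ)) (x, δ)).toReal = (2 * (K : ℝ))⁻¹ := by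
    rw [PMF.uniformOfFintype_apply, hc, ENNReal.toReal_inv]
    simp [mul_comm]
  rw [e, smul_eq_mul, ← mul_assoc, mul_inv_cancel₀ (by positivity), one_mul]
  unfold ring
  split_ifs <;> simp

/-! ### Macroscopic profile -/

/-- The profile `ρ` on the torus `ℝ/ℤ` (seen as a `1`-periodic function) is of class `C²`, takes
values in `[0, 1)`, has exactly the two critical points `0` and `uStar ∈ (0,1)` (where `ρ = 1/2`),
both nondegenerate, and its subcritical phase `{ρ ≤ 1/2}` is the segment `[0, uStar]`. -/
structure IsProfile (ρ : ℝ → ℝ) (uStar : ℝ) : Prop where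
  periodic : Function.Periodic ρ 1
  contDiff : ContDiff ℝ 2 ρ
  nonneg : ∀ u, 0 ≤ ρ u
  lt_one : ∀ u, ρ u < 1
  uStar_mem : uStar ∈ Set.Ioo (0 : ℝ) 1
  critical : {u ∈ Set.Ico (0 : ℝ) 1 | ρ u = 1 / 2} = {0, uStar}
  subcritical : {u ∈ Set.Ico (0 : ℝ) 1 | ρ u ≤ 1 / 2} = Set.Icc 0 uStar
  deriv_ne_zero : ∀ u, ρ u = 1 / 2 → deriv ρ u ≠ 0

/-- The change of coordinates `v(u) = ∫_0^u (1 - ρ)`. -/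
def vMap (ρ : ℝ → ℝ) (u : ℝ) : ℝ := ∫ s in (0 : ℝ)..u, (1 - ρ s)

/-- The constant `c_* = 4 v(1) min {-ρ'(0), ρ'(u_*)}`. -/
def cStar (ρ : ℝ → ℝ) (uStar : ℝ) : ℝ :=
  4 * vMap ρ 1 * min (-(deriv ρ 0)) (deriv ρ uStar)

/-! ### Typical configurations -/

/-- The mesoscopic scale `ℓ_K = ⌊K^{3/4}⌋`. -/
def ell (K : ℕ) : ℕ := ⌊(K : ℝ) ^ (3 / 4 : ℝ)⌋₊

/-- The site `k_* = ⌊K v(u_*) / v(1)⌋`. -/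
def kStar (ρ : ℝ → ℝ) (uStar : ℝ) (K : ℕ) : ℕ := ⌊(K : ℝ) * vMap ρ uStar / vMap ρ 1⌋₊

/-- The bulk `B_K = {ℓ_K, …, k_* - ℓ_K}` of the subcritical phase; its complement is `A_K`. -/
def bulk (ρ : ℝ → ℝ) (uStar : ℝ) (K : ℕ) : Finset (ZMod K) :=
  (Finset.Icc (ell K) (kStar ρ uStar K - ell K)).image fun i : ℕ => (i : ZMod K)

/-- A (possibly empty) connected subset of the discrete torus, for the nearest neighbour graph. -/
def IsConnectedBlock {K : ℕ} (Λ : Set (ZMod K)) : Prop :=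
  ((SimpleGraph.circulantGraph ({1} : Set (ZMod K))).induce Λ).Preconnected

/-- The empirical density of `ω` in `Λ`. -/
def density {K : ℕ} (Λ : Finset (ZMod K)) (ω : Config K) : ℝ :=
  1 / (Λ.card : ℝ) * ∑ x ∈ Λ, (ω x : ℝ)

/-- `α_K = 1 + c ℓ_K / K`. -/
def alphaK (c : ℝ) (K : ℕ) : ℝ := 1 + c * (ell K : ℝ) / (K : ℝ)

/-- `Ω⁺_K` : configurations with `⌊α_K |Λ⁺|⌋` particles in `Λ⁺ = {1, …, 10 ℓ_K}`, no particle
outside `Λ⁺`, and whose particles satisfy `∑_{x ∈ Λ⁺} ω_x (x - 5 ℓ_K) ≤ 0`. -/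
def omegaPlus (c : ℝ) (K : ℕ) : Set (Config K) :=
  {ω | ∑ i ∈ Finset.Icc 1 (10 * ell K), ω (i : ZMod K) = ⌊alphaK c K * ((10 * ell K : ℕ) : ℝ)⌋₊ ∧
    ∑ i ∈ Finset.Icc 1 (10 * ell K), (ω (i : ZMod K) : ℤ) * ((i : ℤ) - 5 * (ell K : ℤ)) ≤ 0 ∧
    ∀ x : ZMod K, (∀ i ∈ Finset.Icc 1 (10 * ell K), x ≠ (i : ZMod K)) → ω x = 0}

/-- `Ω⁻_K` : the image of `Ω⁺_K` under the reflection `x ↦ -x`. -/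
def omegaMinus (c : ℝ) (K : ℕ) : Set (Config K) :=
  {ω | (fun x => ω (-x)) ∈ omegaPlus c K}

/-- The set of typical configurations. The configuration `y ↦ ζ (y - x)` is the translate of
`ζ` by which the origin is moved to `x`. -/
def typical (ρ : ℝ → ℝ) (uStar : ℝ) (K : ℕ) : Set (Config K) :=
  {ω | (∀ x ∈ bulk ρ uStar K, ∀ Λ : Finset (ZMod K), Λ ⊆ bulk ρ uStar K → x ∈ Λ →
        IsConnectedBlock (Λ : Set (ZMod K)) → ell K ≤ Λ.card → density Λ ω ≤ 1) ∧
    (∀ x : ZMod K, x ∉ bulk ρ uStar K →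
      ∃ ζ ∈ omegaPlus (cStar ρ uStar) K ∪ omegaMinus (cStar ρ uStar) K,
        ∀ y : ZMod K, ζ (y - x) ≤ ω y)}

/-! ### Two-phased configurations and the events of interest -/

/-- Two-phased configurations. -/
def twoPhased (K : ℕ) : Set (Config K) :=
  {ω | ∃ A B : Set (ZMod K), Disjoint A B ∧ A ∪ B = Set.univ ∧
    IsConnectedBlock A ∧ IsConnectedBlock B ∧ (∀ x ∈ A, 1 ≤ ω x) ∧ (∀ x ∈ B, ω x ≤ 1)}

/-- The time `T_K = K^{7/4}`. -/
def finalTime (K : ℕ) : ℝ := (K : ℝ) ^ (7 / 4 : ℝ)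

/-- Trajectories with fewer than `log² K` particles at every site up to time `T_K`. -/
def boundedPaths (K : ℕ) : Set (ℝ → Config K) :=
  {w | ∀ x : ZMod K, ∀ t : ℝ, 0 ≤ t → t ≤ finalTime K → ((w t x : ℕ) : ℝ) < Real.log (K : ℝ) ^ 2}

end FacilitatedZR

end

/-!
A path that is not two-phased at time `T_K` has an active site between two empty ones, or an empty
site outside the bulk of the subcritical phase. Both are excluded by letting the process run for
`n ≈ K ^ (21 / 8)` rings only: these take a time of order `K ^ (13 / 8)`, so that by Markov's
inequality they are over before `T_K` (`clockMeasure_late_le`), and it remains to bound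
probabilities for the chain of successive configurations. All these bounds have the form
`clockMeasure_killed_le`: a function `F` whose mean is multiplied by at most `r` at each ring gives
the probability bound `r ^ n F(ω₀)`.

*Freezing.* Consider a segment of length `L` whose two ends stay empty, hence isolated. The excess
particles (all but one at each occupied site), weighted by the concave function `p (L + 1 - p)` of
their coordinate, form a potential which decreases on average by `1 / K` per ring and per active
site, since an excess particle falling into an empty site only loses potential. With at most
`b = log² K` particles per site, the potential is at most `b (L + 1) ^ 2` times the number of active
sites, so it decays at the exponential rate `1 / (K b (L + 1) ^ 2)` and
the segment is frozen after `n` rings if `L` is of order `ℓ_K` (`clockMeasure_active_le`).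

*Subcritical phase.* Around an active site lying between two empty sites, take the nearest empty
sites: the segment in between has never exchanged particles with the outside, and contains more
particles than sites. By the density assumption it is shorter than `ℓ_K`, hence should have been
frozen (`exists_active_segment`).

*Supercritical phase.* Next to a site `x`, keep only the `N > 10 ℓ_K` particles of the
configuration of `Ω⁺ ∪ Ω⁻` below `ω₀`; by attractiveness (`configAfter_mono`) this makes it
harder to visit `x`. If `x` is not visited, these particles freeze on one side of `x`, at distinct
sites, so that their centre of mass has moved away from `x`: the sum of the coordinates has
increased by at least `N (N + 1 - 10 ℓ_K) / 2`, of order `K ^ (5 / 4)`. But it is a martingale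
whose quadratic variation after `n` rings is at most of order `n N / K ≈ K ^ (19 / 8)`, and such a
fluctuation has probability at most `exp (40 - c K ^ (1 / 16))`
(`clockMeasure_not_visited_le`). A union bound over sites and segments concludes.
-/

noncomputable section

namespace FacilitatedZR

/-! ### The clocks: waiting times and number of rings -/

theorem lintegral_ofReal_expMeasure {r : ℝ} (hr : 0 < r) :
    ∫⁻ x, ENNReal.ofReal x ∂(expMeasure r) = ENNReal.ofReal (1 / r) := by
  have h : ∀ x : ℝ, gammaPDF 1 r x * ENNReal.ofReal x =
      ENNReal.ofReal (1 / r) * gammaPDF 2 r x := by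
    intro x
    rcases lt_or_ge x 0 with hx | hx
    · rw [gammaPDF_of_neg hx, gammaPDF_of_neg hx, zero_mul, mul_zero]
    · rw [gammaPDF_of_nonneg hx, gammaPDF_of_nonneg hx, ← ENNReal.ofReal_mul (by positivity),
        ← ENNReal.ofReal_mul' (by rw [Real.Gamma_two]; positivity)]
      congr 1
      rw [Real.Gamma_one, Real.Gamma_two, show (2 : ℝ) - 1 = 1 by norm_num, sub_self,
        Real.rpow_zero, Real.rpow_one, Real.rpow_one, Real.rpow_two]
      field_simp
  unfold expMeasure gammaMeasure
  have hm : ∀ a : ℝ, Measurable (gammaPDF a r) := fun a =>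
    (measurable_gammaPDFReal a r).ennreal_ofReal
  rw [lintegral_withDensity_eq_lintegral_mul _ (hm 1) ENNReal.measurable_ofReal]
  simp only [Pi.mul_apply]
  rw [lintegral_congr h, lintegral_const_mul _ (hm 2),
    lintegral_gammaPDF_eq_one two_pos hr, mul_one]

theorem expMeasure_Iic {r : ℝ} (hr : 0 < r) (x : ℝ) :
    expMeasure r (Set.Iic x) = ENNReal.ofReal (if 0 ≤ x then 1 - Real.exp (-(r * x)) else 0) := by
  rw [← lintegral_exponentialPDF_eq_antiDeriv hr x]
  exact withDensity_apply _ measurableSet_Iic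

section Clocks

variable (K : ℕ) [NeZero K]

instance : IsProbabilityMeasure (clockChoice K) := by
  unfold clockChoice; infer_instance

instance : IsProbabilityMeasure (expMeasure (2 * (K : ℝ))) :=
  isProbabilityMeasure_expMeasure (by have := Nat.pos_of_ne_zero (NeZero.ne K); positivity)

instance : IsProbabilityMeasure (clockMeasure K) := by
  unfold clockMeasure; infer_instance

instance : MeasurableSingletonClass (ZMod K × ℤˣ) := by
  have : MeasurableSingletonClass ℤˣ := ⟨fun δ =>
    ⟨{(δ : ℤ)}, measurableSet_singleton _, by ext ε; simp [Units.ext_iff]⟩⟩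
  infer_instance

theorem card_clocks : Fintype.card (ZMod K × ℤˣ) = 2 * K := by
  rw [Fintype.card_prod, ZMod.card, mul_comm]; rfl

theorem clockChoice_singleton (m : ZMod K × ℤˣ) :
    clockChoice K {m} = ((2 * K : ℕ) : ℝ≥0∞)⁻¹ := by
  unfold clockChoice
  rw [PMF.toMeasure_apply_singleton _ _ (measurableSet_singleton m), PMF.uniformOfFintype_apply,
    card_clocks]

theorem clockMeasure_map_eval (i : ℕ) :
    (clockMeasure K).map (fun ξ => ξ i) = (expMeasure (2 * (K : ℝ))).prod (clockChoice K) :=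
  Measure.infinitePi_map_eval _ i

/-- The first `n` clocks are uniform and independent. -/
theorem clockMeasure_prefix (n : ℕ) (e : ℕ → ZMod K × ℤˣ) :
    clockMeasure K {ξ | ∀ i < n, (ξ i).2 = e i} = (((2 * K : ℕ) : ℝ≥0∞)⁻¹) ^ n := by
  have h := Measure.infinitePi_pi
    (μ := fun _ : ℕ => (expMeasure (2 * (K : ℝ))).prod (clockChoice K))
    (s := Finset.range n) (t := fun i => Set.univ ×ˢ {e i})
    (fun i _ => MeasurableSet.univ.prod (measurableSet_singleton _))
  have hs : {ξ : ℕ → ℝ × (ZMod K × ℤˣ) | ∀ i < n, (ξ i).2 = e i} =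
      Set.pi (Finset.range n : Set ℕ) (fun i => Set.univ ×ˢ {e i}) := by
    ext ξ; simp [Set.mem_pi]
  rw [hs, clockMeasure, h]
  simp [Measure.prod_prod, clockChoice_singleton]

/-- Exponential decay along the chain of successive configurations, killed outside `good`: if one
ring multiplies the mean of `F` by at most `r` at every configuration of `good`, then the
probability to stay in `good` during `n` rings and to end in a set where `F ≥ 1` is at most
`r ^ n F(ω₀)`. -/
theorem clockMeasure_killed_le (ω₀ : Config K) (good B : Set (Config K)) (F : Config K → ℝ)
    {r : ℝ} (hr : 0 ≤ r) (hF : ∀ ω, 0 ≤ F ω) (hB : ∀ ω ∈ B, 1 ≤ F ω)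
    (hstep : ∀ ω ∈ good, ∑ m, F (ring ω m) ≤ 2 * K * (r * F ω)) (n : ℕ) :
    clockMeasure K {ξ | (∀ k < n, configAfter ω₀ ξ k ∈ good) ∧ configAfter ω₀ ξ n ∈ B} ≤
      ENNReal.ofReal (r ^ n * F ω₀) := by
  have hK : (0 : ℝ) < 2 * K := by
    have := Nat.pos_of_ne_zero (NeZero.ne K); positivity
  -- The rings after the `j`-th one, given the first `j` clocks.
  have key : ∀ n j : ℕ, ∀ e : ℕ → ZMod K × ℤˣ, ∀ ω : Config K,
      clockMeasure K {ξ | (∀ i < j, (ξ i).2 = e i) ∧ configAfter ω₀ ξ j = ω ∧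
        (∀ k, j ≤ k → k < j + n → configAfter ω₀ ξ k ∈ good) ∧ configAfter ω₀ ξ (j + n) ∈ B} ≤
      ENNReal.ofReal ((2 * K : ℝ)⁻¹ ^ j * (r ^ n * F ω)) := by
    intro n
    induction n with
    | zero =>
      intro j e ω
      by_cases hω : ω ∈ B
      · refine (measure_mono (t := {ξ | ∀ i < j, (ξ i).2 = e i}) fun ξ hξ => hξ.1).trans ?_
        rw [clockMeasure_prefix]
        have : (((2 * K : ℕ) : ℝ≥0∞)⁻¹) ^ j = ENNReal.ofReal ((2 * K : ℝ)⁻¹ ^ j) := by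
          rw [ENNReal.ofReal_pow (by positivity), ENNReal.ofReal_inv_of_pos hK]
          congr 2
          rw [← ENNReal.ofReal_natCast]; push_cast; rfl
        rw [this]
        refine ENNReal.ofReal_le_ofReal ?_
        rw [pow_zero, one_mul]
        exact le_mul_of_one_le_right (by positivity) (hB ω hω)
      · refine (measure_mono (t := ∅) fun ξ hξ => hω ?_).trans (by simp)
        have h1 := hξ.2.2.2
        rw [add_zero, hξ.2.1] at h1
        exact h1
    | succ n ih =>
      intro j e ω
      by_cases hω : ω ∈ good
      · calc _ ≤ clockMeasure K (⋃ m : ZMod K × ℤˣ,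
              {ξ | (∀ i < j + 1, (ξ i).2 = Function.update e j m i) ∧
                configAfter ω₀ ξ (j + 1) = ring ω m ∧
                (∀ k, j + 1 ≤ k → k < j + 1 + n → configAfter ω₀ ξ k ∈ good) ∧
                configAfter ω₀ ξ (j + 1 + n) ∈ B}) := by
              refine measure_mono fun ξ ⟨h1, h2, h3, h4⟩ => ?_
              refine Set.mem_iUnion.2 ⟨(ξ j).2, fun i hi => ?_, ?_, fun k hk hk' => ?_, ?_⟩
              · rcases Nat.lt_succ_iff_lt_or_eq.1 hi with h | rfl
                · rw [Function.update_of_ne h.ne, h1 i h]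
                · rw [Function.update_self]
              · rw [configAfter, h2]
              · exact h3 k (by omega) (by omega)
              · rwa [show j + 1 + n = j + (n + 1) by omega]
          _ ≤ ∑ m : ZMod K × ℤˣ,
              ENNReal.ofReal ((2 * K : ℝ)⁻¹ ^ (j + 1) * (r ^ n * F (ring ω m))) :=
              (measure_iUnion_fintype_le _ _).trans
                (Finset.sum_le_sum fun m _ => ih (j + 1) (Function.update e j m) (ring ω m))
          _ = ENNReal.ofReal (∑ m : ZMod K × ℤˣ,
              (2 * K : ℝ)⁻¹ ^ (j + 1) * (r ^ n * F (ring ω m))) :=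
              (ENNReal.ofReal_sum_of_nonneg fun m _ =>
                mul_nonneg (by positivity) (mul_nonneg (by positivity) (hF _))).symm
          _ ≤ _ := by
              refine ENNReal.ofReal_le_ofReal ?_
              rw [← Finset.mul_sum, ← Finset.mul_sum]
              calc _ ≤ (2 * K : ℝ)⁻¹ ^ (j + 1) * (r ^ n * (2 * K * (r * F ω))) := by
                    gcongr; exact hstep ω hω
                _ = _ := by
                    generalize (2 * K : ℝ) = c at hK ⊢
                    rw [pow_succ, pow_succ]
                    field_simp
      · refine (measure_mono (t := ∅) fun ξ hξ => hω ?_).trans (by simp)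
        have h1 := hξ.2.2.1 j le_rfl (by omega)
        rwa [hξ.2.1] at h1
  obtain ⟨e⟩ : Nonempty (ℕ → ZMod K × ℤˣ) := inferInstance
  have h := key n 0 e ω₀
  rw [pow_zero, one_mul] at h
  refine (measure_mono fun ξ hξ => ?_).trans h
  exact ⟨by simp, rfl, fun k _ hk => hξ.1 k (by omega), by rw [zero_add]; exact hξ.2⟩

/-- By Markov's inequality, the `n`-th ring takes place before time `t` with high probability as
soon as `n` is much smaller than its mean value `2 K t`. -/
theorem clockMeasure_late_le (n : ℕ) {t : ℝ} (ht : 0 < t) :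
    clockMeasure K {ξ | t < ∑ i ∈ Finset.range n, (ξ i).1} ≤
      ENNReal.ofReal (n / (2 * K * t)) := by
  have hK : (0 : ℝ) < 2 * K := by
    have := Nat.pos_of_ne_zero (NeZero.ne K); positivity
  have hmean : ∀ i : ℕ, ∫⁻ ξ, ENNReal.ofReal (ξ i).1 ∂(clockMeasure K) =
      ENNReal.ofReal (1 / (2 * K)) := by
    intro i
    have h1 : ∫⁻ p : ℝ × (ZMod K × ℤˣ), ENNReal.ofReal p.1
        ∂((clockMeasure K).map (fun ξ => ξ i)) = ∫⁻ ξ, ENNReal.ofReal (ξ i).1 ∂(clockMeasure K) :=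
      lintegral_map (by fun_prop) (by fun_prop)
    rw [← h1, clockMeasure_map_eval, lintegral_prod _ (by fun_prop)]
    simp [lintegral_ofReal_expMeasure hK]
  have hm : Measurable fun ξ : ℕ → ℝ × (ZMod K × ℤˣ) =>
      ∑ i ∈ Finset.range n, ENNReal.ofReal (ξ i).1 := by fun_prop
  calc _ ≤ clockMeasure K {ξ | ENNReal.ofReal t ≤
          ∑ i ∈ Finset.range n, ENNReal.ofReal (ξ i).1} := by
        refine measure_mono fun ξ hξ => ?_
        refine (ENNReal.ofReal_le_ofReal (le_of_lt hξ)).trans ?_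
        generalize Finset.range n = s
        induction s using Finset.induction_on with
        | empty => simp
        | insert a s ha ih =>
          rw [Finset.sum_insert ha, Finset.sum_insert ha]
          exact ENNReal.ofReal_add_le.trans (by gcongr)
    _ ≤ (∫⁻ ξ, ∑ i ∈ Finset.range n, ENNReal.ofReal (ξ i).1 ∂(clockMeasure K)) /
          ENNReal.ofReal t :=
        meas_ge_le_lintegral_div hm.aemeasurable (by simpa using ht) ENNReal.ofReal_ne_top
    _ = _ := by
        rw [lintegral_finsetSum _ (fun i _ => by fun_prop)]
        simp only [hmean, Finset.sum_const, Finset.card_range, nsmul_eq_mul]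
        rw [← ENNReal.ofReal_natCast, ← ENNReal.ofReal_mul (by positivity),
          ← ENNReal.ofReal_div_of_pos ht]
        congr 1
        field_simp

theorem ae_waitingTime_pos : ∀ᵐ ξ ∂(clockMeasure K), ∀ i, 0 < (ξ i).1 := by
  have hK : (0 : ℝ) < 2 * K := by
    have := Nat.pos_of_ne_zero (NeZero.ne K); positivity
  refine ae_all_iff.2 fun i => ?_
  have h1 : (clockMeasure K).map (fun ξ => ξ i) (Set.Iic 0 ×ˢ Set.univ) = 0 := by
    rw [clockMeasure_map_eval, Measure.prod_prod, expMeasure_Iic hK]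
    simp
  rw [Measure.map_apply (by fun_prop) (measurableSet_Iic.prod MeasurableSet.univ)] at h1
  rw [ae_iff]
  convert! h1 using 2
  ext ξ; simp

/-- Almost surely, only finitely many rings take place before time `t`. -/
theorem ae_exists_late (t : ℝ) :
    ∀ᵐ ξ ∂(clockMeasure K), ∃ n, t < ∑ i ∈ Finset.range n, (ξ i).1 := by
  have hK : (0 : ℝ) < 2 * K := by
    have := Nat.pos_of_ne_zero (NeZero.ne K); positivity
  -- It suffices that some waiting time exceeds `t`.
  have h0 : clockMeasure K {ξ | ∀ i, (ξ i).1 ≤ t} = 0 := by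
    set q := expMeasure (2 * (K : ℝ)) (Set.Iic t) with hq
    have hq1 : q < 1 := by
      rw [hq, expMeasure_Iic hK, ← ENNReal.ofReal_one,
        ENNReal.ofReal_lt_ofReal_iff one_pos]
      split_ifs
      · linarith [Real.exp_pos (-(2 * K * t))]
      · norm_num
    have hle : ∀ n : ℕ, clockMeasure K {ξ | ∀ i, (ξ i).1 ≤ t} ≤ q ^ n := by
      intro n
      have h := Measure.infinitePi_pi
        (μ := fun _ : ℕ => (expMeasure (2 * (K : ℝ))).prod (clockChoice K))
        (s := Finset.range n) (t := fun _ => Set.Iic t ×ˢ Set.univ)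
        (fun i _ => measurableSet_Iic.prod MeasurableSet.univ)
      simp only [Measure.prod_prod, measure_univ, mul_one, Finset.prod_const,
        Finset.card_range] at h
      rw [hq, ← h]
      refine measure_mono fun ξ hξ => ?_
      simp only [Set.mem_pi, Set.mem_prod, Set.mem_Iic, Set.mem_univ, and_true]
      exact fun i _ => hξ i
    exact le_antisymm (ge_of_tendsto' (ENNReal.tendsto_pow_atTop_nhds_zero_of_lt_one hq1) hle)
      bot_le
  have h1 : ∀ᵐ ξ ∂(clockMeasure K), ¬ ∀ i, (ξ i).1 ≤ t := by
    rw [ae_iff]; simpa using h0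
  filter_upwards [h1, ae_waitingTime_pos K] with ξ h2 h3
  push Not at h2
  obtain ⟨i, hi⟩ := h2
  refine ⟨i + 1, hi.trans_le ?_⟩
  rw [Finset.sum_range_succ]
  exact le_add_of_nonneg_left (Finset.sum_nonneg fun j _ => (h3 j).le)

end Clocks

section RingCount

variable {K : ℕ} {ξ : ℕ → ℝ × (ZMod K × ℤˣ)}

theorem strictMono_ringTime (hpos : ∀ i, 0 < (ξ i).1) :
    StrictMono fun n => ∑ i ∈ Finset.range n, (ξ i).1 :=
  strictMono_nat_of_lt_succ fun n => by
    rw [Finset.sum_range_succ]; exact lt_add_of_pos_right _ (hpos n)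

theorem ringCount_eq {t : ℝ} {n : ℕ} (hpos : ∀ i, 0 < (ξ i).1)
    (h1 : ∑ i ∈ Finset.range n, (ξ i).1 ≤ t) (h2 : t < ∑ i ∈ Finset.range (n + 1), (ξ i).1) :
    ringCount ξ t = n := by
  have hs : {k : ℕ | ∑ i ∈ Finset.range (k + 1), (ξ i).1 ≤ t} = Set.Iio n := by
    ext k
    simp only [Set.mem_ofPred_eq, Set.mem_Iio]
    constructor
    · intro h
      by_contra! hk
      exact absurd (h2.trans_le ((strictMono_ringTime hpos).monotone (Nat.succ_le_succ hk)))
        (not_lt.2 h)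
    · intro h
      exact ((strictMono_ringTime hpos).monotone (Nat.succ_le_of_lt h)).trans h1
  rw [ringCount, hs, Set.ncard_eq_toFinset_card', Set.toFinset_Iio, Nat.card_Iio]

/-- Up to time `t`, the path visits exactly the configurations reached after at most
`ringCount ξ t` rings. -/
theorem exists_time_of_le_ringCount {t : ℝ} (ht : 0 ≤ t) (hpos : ∀ i, 0 < (ξ i).1)
    (hlate : ∃ n, t < ∑ i ∈ Finset.range n, (ξ i).1) {n : ℕ} (hn : n ≤ ringCount ξ t) :
    ∃ s, 0 ≤ s ∧ s ≤ t ∧ ringCount ξ s = n := by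
  classical
  obtain ⟨j, hj⟩ : ∃ j, Nat.find hlate = j + 1 := Nat.exists_eq_succ_of_ne_zero fun h => by
    have := Nat.find_spec hlate
    rw [h] at this
    simp at this
    linarith
  have hcount : ringCount ξ t = j :=
    ringCount_eq hpos (not_lt.1 (Nat.find_min hlate (by omega))) (hj ▸ Nat.find_spec hlate)
  refine ⟨∑ i ∈ Finset.range n, (ξ i).1, Finset.sum_nonneg fun i _ => (hpos i).le, ?_,
    ringCount_eq hpos le_rfl (strictMono_ringTime hpos n.lt_succ_self)⟩
  exact not_lt.1 (Nat.find_min hlate (by omega))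

theorem le_ringCount {t : ℝ} {n : ℕ} (hpos : ∀ i, 0 < (ξ i).1)
    (hlate : ∃ n, t < ∑ i ∈ Finset.range n, (ξ i).1)
    (hn : ∑ i ∈ Finset.range n, (ξ i).1 ≤ t) : n ≤ ringCount ξ t := by
  classical
  have hlt : n < Nat.find hlate := by
    by_contra! h
    exact absurd ((Nat.find_spec hlate).trans_le ((strictMono_ringTime hpos).monotone h))
      (not_lt.2 hn)
  obtain ⟨j, hj⟩ : ∃ j, Nat.find hlate = j + 1 := Nat.exists_eq_succ_of_ne_zero (by omega)
  rw [ringCount_eq hpos (not_lt.1 (Nat.find_min hlate (by omega)))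
    (hj ▸ Nat.find_spec hlate)]
  omega

end RingCount

/-! ### Coordinates on the torus -/

section Coordinates

variable {K : ℕ}

/-- The coordinate in `{0, …, K - 1}` of the site `y` when the torus is unrolled from the
origin `c`, in the increasing direction if `s = 1` and in the decreasing one if `s = -1`. -/
def pos (c : ZMod K) (s : ℤˣ) (y : ZMod K) : ℕ := (((s : ℤ) : ZMod K) * (y - c)).val

/-- The site of coordinate `i`, see `pos`. -/
def site (c : ZMod K) (s : ℤˣ) (i : ℕ) : ZMod K := c + ((s : ℤ) : ZMod K) * i

variable (c : ZMod K) (s : ℤˣ)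

theorem sign_mul_self : (((s : ℤ) : ZMod K)) * ((s : ℤ) : ZMod K) = 1 := by
  rcases Int.units_eq_one_or s with rfl | rfl <;> simp

theorem site_zero : site c s 0 = c := by simp [site]

theorem pos_self : pos c s c = 0 := by simp [pos]

theorem sum_sign {M : Type*} [AddCommMonoid M] (f : ℤˣ → M) : ∑ δ, f δ = f s + f (-s) := by
  have h : (Finset.univ : Finset ℤˣ) = {s, -s} := by
    ext δ
    rcases Int.units_eq_one_or s with rfl | rfl <;>
      rcases Int.units_eq_one_or δ with rfl | rfl <;> simp
  rw [h, Finset.sum_pair]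
  rcases Int.units_eq_one_or s with rfl | rfl <;> decide

theorem eq_or_eq_neg (s δ : ℤˣ) : δ = s ∨ δ = -s := by
  rcases Int.units_eq_one_or s with rfl | rfl <;>
    rcases Int.units_eq_one_or δ with rfl | rfl <;> simp

/-- The image of an interval of `ℕ` is connected. -/
theorem isConnectedBlock_interval (i j : ℕ) :
    IsConnectedBlock ((fun k : ℕ => c + (k : ZMod K)) '' Set.Icc i j) := by
  unfold IsConnectedBlock
  set Λ := (fun k : ℕ => c + (k : ZMod K)) '' Set.Icc i j with hΛ
  have hmem : ∀ k, i ≤ k → k ≤ j → c + (k : ZMod K) ∈ Λ := fun k h1 h2 => ⟨k, ⟨h1, h2⟩, rfl⟩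
  -- Every site of the interval is connected to its left end.
  have key : ∀ k (h1 : i ≤ k) (h2 : k ≤ j),
      ((SimpleGraph.circulantGraph ({1} : Set (ZMod K))).induce Λ).Reachable
        ⟨c + (i : ZMod K), hmem i le_rfl (h1.trans h2)⟩ ⟨c + (k : ZMod K), hmem k h1 h2⟩ := by
    intro k h1
    induction k, h1 using Nat.le_induction with
    | base => exact fun _ => SimpleGraph.Reachable.refl _
    | succ k hk ih =>
      intro h2
      refine (ih (by omega)).trans ?_
      by_cases heq : c + (k : ZMod K) = c + ((k + 1 : ℕ) : ZMod K)
      · simp only [heq]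
        exact SimpleGraph.Reachable.refl _
      · refine SimpleGraph.Adj.reachable ?_
        simp only [SimpleGraph.comap_adj, Function.Embedding.subtype_apply,
          SimpleGraph.circulantGraph_adj]
        refine ⟨heq, .inr ?_⟩
        simp
  rintro ⟨x, kx, ⟨hx1, hx2⟩, rfl⟩ ⟨y, ky, ⟨hy1, hy2⟩, rfl⟩
  exact (key kx hx1 hx2).symm.trans (key ky hy1 hy2)

theorem pos_site {i : ℕ} (hi : i < K) : pos c s (site c s i) = i := by
  rw [site, pos, add_sub_cancel_left, ← mul_assoc, sign_mul_self, one_mul, ZMod.val_natCast,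
    Nat.mod_eq_of_lt hi]

variable [NeZero K]

theorem pos_lt (y : ZMod K) : pos c s y < K := ZMod.val_lt _

theorem site_pos (y : ZMod K) : site c s (pos c s y) = y := by
  rw [site, pos, ZMod.natCast_zmod_val, ← mul_assoc, sign_mul_self]; ring

theorem pos_injective : Function.Injective (pos c s) :=
  Function.LeftInverse.injective (site_pos c s)

/-- Moving one step in the direction `s` increases the coordinate by one. -/
theorem pos_neighbour_same {y : ZMod K} (hy : pos c s y + 1 < K) :
    pos c s (neighbour y s) = pos c s y + 1 := by
  have h : neighbour y s = site c s (pos c s y + 1) := by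
    conv_lhs => rw [← site_pos c s y]
    simp only [neighbour, site]
    push_cast
    ring
  rw [h, pos_site c s hy]

/-- Moving one step in the direction `-s` decreases the coordinate by one. -/
theorem pos_neighbour_neg {y : ZMod K} (hy : 1 ≤ pos c s y) :
    pos c s (neighbour y (-s)) = pos c s y - 1 := by
  have h : neighbour y (-s) = site c s (pos c s y - 1) := by
    conv_lhs => rw [← site_pos c s y]
    simp only [neighbour, site]
    push_cast [Nat.cast_sub hy]
    ring
  rw [h, pos_site c s ((Nat.sub_le _ _).trans_lt (pos_lt c s y))]

theorem pos_neighbour_last {y : ZMod K} (hy : pos c s y + 1 = K) :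
    pos c s (neighbour y s) = 0 := by
  have h : neighbour y s = site c s 0 := by
    conv_lhs => rw [← site_pos c s y]
    have h1 : ((pos c s y : ℕ) : ZMod K) + 1 = 0 := by
      have := ZMod.natCast_self K
      rw [← Nat.cast_succ, Nat.succ_eq_add_one, hy, this]
    simp only [neighbour, site]
    rw [eq_neg_of_add_eq_zero_left h1]
    push_cast
    ring
  rw [h, site_zero, pos_self]

/-- A jump changes the coordinate by at most one, as long as it does not cross the bond between
the coordinates `K - 1` and `0`. -/
theorem pos_neighbour_cases {y : ZMod K} (h1 : 1 ≤ pos c s y) (h2 : pos c s y + 1 < K) (δ : ℤˣ) :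
    pos c s (neighbour y δ) = pos c s y + 1 ∨ pos c s (neighbour y δ) = pos c s y - 1 := by
  rcases eq_or_eq_neg s δ with rfl | rfl
  · exact .inl (pos_neighbour_same c _ h2)
  · exact .inr (pos_neighbour_neg c s h1)

end Coordinates

/-! ### Deterministic properties of the dynamics -/

section Dynamics

variable {K : ℕ}

theorem ring_of_lt {ω : Config K} {m : ZMod K × ℤˣ} (h : ω m.1 < 2) : ring ω m = ω := by
  rw [ring, if_neg (by omega)]

theorem ring_of_le {ω : Config K} {m : ZMod K × ℤˣ} (h : 2 ≤ ω m.1) :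
    ring ω m = moveParticle ω m.1 (neighbour m.1 m.2) := by
  rw [ring, if_pos h]

/-- The process is attractive: trajectories driven by the same clocks remain ordered. -/
theorem ring_mono {η ω : Config K} (h : η ≤ ω) (m : ZMod K × ℤˣ) : ring η m ≤ ring ω m := by
  intro z
  have hz : η z ≤ ω z := h z
  have hx : η m.1 ≤ ω m.1 := h m.1
  have hy : η (neighbour m.1 m.2) ≤ ω (neighbour m.1 m.2) := h (neighbour m.1 m.2)
  change (ring η m z : ℕ) ≤ ring ω m z
  simp only [ring, moveParticle, ite_apply]
  split_ifs <;> subst_vars <;> omega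

theorem configAfter_mono {η ω : Config K} (h : η ≤ ω) (ξ : ℕ → ℝ × (ZMod K × ℤˣ)) (n : ℕ) :
    configAfter η ξ n ≤ configAfter ω ξ n := by
  induction n with
  | zero => exact h
  | succ n ih => exact ring_mono ih _

/-- An occupied site remains occupied. -/
theorem ring_pos {ω : Config K} {y : ZMod K} (h : 1 ≤ ω y) (m : ZMod K × ℤˣ) :
    1 ≤ ring ω m y := by
  simp only [ring, moveParticle, ite_apply]
  split_ifs <;> subst_vars <;> omega

theorem configAfter_eq_zero {ω : Config K} {ξ : ℕ → ℝ × (ZMod K × ℤˣ)} {k n : ℕ} {y : ZMod K}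
    (hkn : k ≤ n) (h : configAfter ω ξ n y = 0) : configAfter ω ξ k y = 0 := by
  by_contra hk
  have : ∀ n, k ≤ n → 1 ≤ configAfter ω ξ n y := fun n hn => by
    induction n, hn using Nat.le_induction with
    | base => omega
    | succ n _ ih => exact ring_pos ih _
  have := this n hkn
  omega

theorem sum_moveParticle_le {ω : Config K} {x v : ZMod K} (hx : 1 ≤ ω x) (S : Finset (ZMod K))
    (hv : v ∈ S → x ∈ S) : ∑ y ∈ S, moveParticle ω x v y ≤ ∑ y ∈ S, ω y := by
  have hpt : ∀ y ∈ S, moveParticle ω x v y + (if y = x then 1 else 0) ≤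
      ω y + if y = v then 1 else 0 := by
    intro y _
    simp only [moveParticle]
    split_ifs <;> simp_all
  have h := Finset.sum_le_sum hpt
  rw [Finset.sum_add_distrib, Finset.sum_add_distrib, Finset.sum_ite_eq', Finset.sum_ite_eq'] at h
  by_cases h1 : v ∈ S
  · simpa [h1, hv h1] using h
  · simp only [h1, if_false] at h
    split_ifs at h <;> omega

variable [NeZero K]

/-- The number of particles on the sites with coordinates in `{1, …, L}`. -/
def segmentMass (c : ZMod K) (s : ℤˣ) (L : ℕ) (ω : Config K) : ℕ :=
  ∑ y with 1 ≤ pos c s y ∧ pos c s y ≤ L, ω y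

theorem sum_ring {ω : Config K} (hK : 1 < K) (m : ZMod K × ℤˣ) :
    ∑ y, ring ω m y = ∑ y, ω y := by
  by_cases h2 : 2 ≤ ω m.1
  · rw [ring_of_le h2]
    have hne : neighbour m.1 m.2 ≠ m.1 := by
      have : Fact (1 < K) := ⟨hK⟩
      unfold neighbour
      rcases Int.units_eq_one_or m.2 with h | h <;> simp [h]
    have hpt : ∀ y, moveParticle ω m.1 (neighbour m.1 m.2) y + (if y = m.1 then 1 else 0) =
        ω y + if y = neighbour m.1 m.2 then 1 else 0 := by
      intro y
      simp only [moveParticle]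
      split_ifs <;> simp_all
      omega
    have h := Finset.sum_congr (rfl : (Finset.univ : Finset (ZMod K)) = Finset.univ)
      fun y _ => hpt y
    rw [Finset.sum_add_distrib, Finset.sum_add_distrib, Finset.sum_ite_eq', Finset.sum_ite_eq'] at h
    simpa using h
  · rw [ring_of_lt (by omega)]

/-- A site inside a segment with empty ends receives particles only from inside the segment. -/
theorem pos_source_mem {ω : Config K} {c : ZMod K} {s : ℤˣ} {L : ℕ}
    (h0 : ω (site c s 0) = 0) (h1 : ω (site c s (L + 1)) = 0) {x : ZMod K} {δ : ℤˣ}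
    (hx : 2 ≤ ω x) (hv : 1 ≤ pos c s (neighbour x δ)) (hv' : pos c s (neighbour x δ) ≤ L) :
    1 ≤ pos c s x ∧ pos c s x ≤ L := by
  have hx0 : pos c s x ≠ 0 := fun h => by
    rw [← h, site_pos] at h0; omega
  have hx1 : pos c s x ≠ L + 1 := fun h => by
    rw [← h, site_pos] at h1; omega
  refine ⟨by omega, ?_⟩
  rcases eq_or_eq_neg s δ with rfl | rfl
  · rcases Nat.lt_or_ge (pos c δ x + 1) K with h | h
    · rw [pos_neighbour_same c _ h] at hv'; omega
    · have := pos_lt c δ x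
      rw [pos_neighbour_last c _ (by omega)] at hv; omega
  · rw [pos_neighbour_neg c s (by omega)] at hv'; omega

theorem segmentMass_ring_le {ω : Config K} {c : ZMod K} {s : ℤˣ} {L : ℕ}
    (h0 : ω (site c s 0) = 0) (h1 : ω (site c s (L + 1)) = 0) (m : ZMod K × ℤˣ) :
    segmentMass c s L (ring ω m) ≤ segmentMass c s L ω := by
  by_cases h2 : 2 ≤ ω m.1
  · rw [ring_of_le h2]
    refine sum_moveParticle_le (by omega) _ fun hv => ?_
    simp only [Finset.mem_filter_univ] at hv ⊢
    exact pos_source_mem h0 h1 h2 hv.1 hv.2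
  · rw [ring_of_lt (by omega)]

/-- A segment whose ends remain empty does not gain particles. -/
theorem segmentMass_configAfter_le {ω : Config K} {ξ : ℕ → ℝ × (ZMod K × ℤˣ)} {c : ZMod K}
    {s : ℤˣ} {L n : ℕ} (h0 : configAfter ω ξ n (site c s 0) = 0)
    (h1 : configAfter ω ξ n (site c s (L + 1)) = 0) :
    segmentMass c s L (configAfter ω ξ n) ≤ segmentMass c s L ω := by
  induction n with
  | zero => exact le_rfl
  | succ n ih =>
    have h0' := configAfter_eq_zero n.le_succ h0
    have h1' := configAfter_eq_zero n.le_succ h1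
    exact (segmentMass_ring_le h0' h1' _).trans (ih h0' h1')

/-- A segment without active sites, and whose ends remain empty, is frozen. -/
theorem frozen_configAfter {ω : Config K} {ξ : ℕ → ℝ × (ZMod K × ℤˣ)} {c : ZMod K}
    {s : ℤˣ} {L k n : ℕ} (hkn : k ≤ n)
    (h0 : configAfter ω ξ n (site c s 0) = 0) (h1 : configAfter ω ξ n (site c s (L + 1)) = 0)
    (hk : ∀ y, 1 ≤ pos c s y → pos c s y ≤ L → configAfter ω ξ k y ≤ 1) :
    ∀ y, 1 ≤ pos c s y → pos c s y ≤ L → configAfter ω ξ n y ≤ 1 := by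
  induction n, hkn using Nat.le_induction with
  | base => exact hk
  | succ n hn ih =>
    have h0' := configAfter_eq_zero n.le_succ h0
    have h1' := configAfter_eq_zero n.le_succ h1
    have ih := ih h0' h1'
    intro y hy hy'
    have hy1 := ih y hy hy'
    rw [configAfter]
    set η := configAfter ω ξ n
    by_cases h2 : 2 ≤ η (ξ n).2.1
    · rw [ring_of_le h2, moveParticle]
      split_ifs with e1 e2
      · rw [← e1]; omega
      · subst e2
        have h := pos_source_mem h0' h1' h2 hy hy'
        have := ih _ h.1 h.2
        omega
      · exact hy1
    · rwa [ring_of_lt (by omega)]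

end Dynamics

/-! ### Freezing of an isolated segment -/

section Freezing

/-- The concave function `p ↦ p (L + 1 - p)` on `{0, …, L + 1}`, extended by `0`. -/
def tent (L p : ℕ) : ℕ := p * (L + 1 - p)

theorem tent_drift {L p : ℕ} (h1 : 1 ≤ p) (h2 : p ≤ L) :
    tent L (p + 1) + tent L (p - 1) + 2 = 2 * tent L p := by
  obtain ⟨p, rfl⟩ := Nat.exists_eq_add_of_le' h1
  obtain ⟨q, rfl⟩ := Nat.exists_eq_add_of_le h2
  simp only [tent]
  rw [show p + 1 + q + 1 - (p + 1 + 1) = q by omega, show p + 1 - 1 = p by omega,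
    show p + 1 + q + 1 - p = q + 2 by omega, show p + 1 + q + 1 - (p + 1) = q + 1 by omega]
  ring

theorem tent_eq_zero {L p : ℕ} (h : L + 1 ≤ p) : tent L p = 0 := by
  rw [tent, Nat.sub_eq_zero_of_le h, mul_zero]

theorem tent_le (L p : ℕ) : tent L p ≤ (L + 1) ^ 2 := by
  rcases Nat.lt_or_ge (L + 1) p with h | h
  · rw [tent_eq_zero h.le]; exact Nat.zero_le _
  · rw [tent, pow_two]; exact Nat.mul_le_mul h (Nat.sub_le _ _)

theorem tent_pos {L p : ℕ} (h1 : 1 ≤ p) (h2 : p ≤ L) : 1 ≤ tent L p :=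
  Nat.mul_pos h1 (by omega)

variable {K : ℕ} [NeZero K] (c : ZMod K) (s : ℤˣ) (L : ℕ)

/-- The potential of the excess particles (all the particles of a site but one) of a segment,
where a particle at coordinate `p` has potential `tent L p`. -/
def excess (ω : Config K) : ℕ := ∑ y, (ω y - 1) * tent L (pos c s y)

/-- The active sites of the segment `{1, …, L}`. -/
def activeSites (ω : Config K) : Finset (ZMod K) :=
  {y | (1 ≤ pos c s y ∧ pos c s y ≤ L) ∧ 2 ≤ ω y}

variable {c s L}

theorem excess_moveParticle_le {ω : Config K} {x : ZMod K} (hx : 2 ≤ ω x) (v : ZMod K) :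
    excess c s L (moveParticle ω x v) + tent L (pos c s x) ≤
      excess c s L ω + tent L (pos c s v) := by
  have hpt : ∀ y ∈ (Finset.univ : Finset (ZMod K)),
      (moveParticle ω x v y - 1) * tent L (pos c s y) + (if y = x then tent L (pos c s y) else 0) ≤
        (ω y - 1) * tent L (pos c s y) + if y = v then tent L (pos c s y) else 0 := by
    intro y _
    have h : (moveParticle ω x v y - 1) + (if y = x then 1 else 0) ≤
        (ω y - 1) + if y = v then 1 else 0 := by
      simp only [moveParticle]
      split_ifs <;> subst_vars <;> omega
    have h' := Nat.mul_le_mul_right (tent L (pos c s y)) h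
    simpa only [add_mul, ite_mul, one_mul, zero_mul] using h'
  have h := Finset.sum_le_sum hpt
  rw [Finset.sum_add_distrib, Finset.sum_add_distrib, Finset.sum_ite_eq', Finset.sum_ite_eq'] at h
  simpa [excess] using h

/-- As long as the ends of the segment are empty, the potential decreases on average by `1 / K`
per active site and per ring. -/
theorem sum_excess_ring_le {ω : Config K} (hL : L + 1 < K) (h0 : ω (site c s 0) = 0)
    (h1 : ω (site c s (L + 1)) = 0) :
    ∑ m, excess c s L (ring ω m) + 2 * (activeSites c s L ω).card ≤
      2 * K * excess c s L ω := by
  have hx : ∀ x ∈ (Finset.univ : Finset (ZMod K)), ∑ δ, excess c s L (ring ω (x, δ)) +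
      2 * (if (1 ≤ pos c s x ∧ pos c s x ≤ L) ∧ 2 ≤ ω x then 1 else 0) ≤
        2 * excess c s L ω := by
    intro x _
    rw [sum_sign s]
    by_cases h2 : 2 ≤ ω x
    · rw [ring_of_le (m := (x, s)) h2, ring_of_le (m := (x, -s)) h2]
      have hs := excess_moveParticle_le (c := c) (s := s) (L := L) h2 (neighbour x s)
      have hn := excess_moveParticle_le (c := c) (s := s) (L := L) h2 (neighbour x (-s))
      have hx0 : pos c s x ≠ 0 := fun h => by rw [← h, site_pos] at h0; omega
      have hx1 : pos c s x ≠ L + 1 := fun h => by rw [← h, site_pos] at h1; omega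
      rw [pos_neighbour_neg c s (by omega)] at hn
      by_cases hx2 : pos c s x ≤ L
      · rw [pos_neighbour_same c s (by omega)] at hs
        have := tent_drift (L := L) (p := pos c s x) (by omega) hx2
        rw [if_pos ⟨⟨by omega, hx2⟩, h2⟩]
        simp only
        omega
      · have e1 : tent L (pos c s (neighbour x s)) = 0 := by
          rcases Nat.lt_or_ge (pos c s x + 1) K with h | h
          · rw [pos_neighbour_same c s h]; exact tent_eq_zero (by omega)
          · have := pos_lt c s x
            rw [pos_neighbour_last c s (by omega), tent, zero_mul]
        have e2 : tent L (pos c s x - 1) = 0 := tent_eq_zero (by omega)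
        rw [if_neg (by omega)]
        simp only
        omega
    · rw [ring_of_lt (m := (x, s)) (by simpa using h2), ring_of_lt (m := (x, -s))
        (by simpa using h2), if_neg (by omega)]
      omega
  have h := Finset.sum_le_sum hx
  rw [Finset.sum_add_distrib, ← Finset.mul_sum, ← Finset.card_filter, Finset.sum_const,
    Finset.card_univ, ZMod.card, smul_eq_mul] at h
  rw [Fintype.sum_prod_type]
  calc _ ≤ K * (2 * excess c s L ω) := h
    _ = _ := by ring

theorem excess_le {ω : Config K} {b : ℕ} (hb : ∀ y, ω y ≤ b) :
    excess c s L ω ≤ (activeSites c s L ω).card * (b * (L + 1) ^ 2) := by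
  unfold excess activeSites
  rw [Finset.card_filter, Finset.sum_mul]
  refine Finset.sum_le_sum fun y _ => ?_
  split_ifs with h
  · rw [one_mul]
    exact Nat.mul_le_mul ((Nat.sub_le _ _).trans (hb y)) (tent_le L _)
  · rw [zero_mul, Nat.le_zero, mul_eq_zero]
    by_cases h2 : 2 ≤ ω y
    · right
      rcases Nat.eq_zero_or_pos (pos c s y) with h3 | h3
      · rw [h3, tent, zero_mul]
      · exact tent_eq_zero (by omega)
    · left; omega

theorem one_le_excess {ω : Config K} {y : ZMod K} (h1 : 1 ≤ pos c s y) (h2 : pos c s y ≤ L)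
    (hy : 2 ≤ ω y) : 1 ≤ excess c s L ω :=
  calc 1 ≤ (ω y - 1) * tent L (pos c s y) := Nat.mul_pos (by omega) (tent_pos h1 h2)
    _ ≤ _ := Finset.single_le_sum (f := fun y => (ω y - 1) * tent L (pos c s y))
        (fun _ _ => Nat.zero_le _) (Finset.mem_univ y)

/-- A segment whose ends remain empty, with at most `b` particles per site, freezes after about
`K b (L + 1) ^ 2` rings. -/
theorem clockMeasure_active_le (hL : L + 1 < K) {b : ℕ} {D : ℝ} (hD1 : 1 ≤ D)
    (hD : (K * (b * (L + 1) ^ 2) : ℕ) ≤ D) {ω₀ : Config K} (hω₀ : ∀ y, ω₀ y ≤ b) (n : ℕ) :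
    clockMeasure K {ξ | (∀ k < n, configAfter ω₀ ξ k ∈ {ω : Config K |
        ω (site c s 0) = 0 ∧ ω (site c s (L + 1)) = 0 ∧ ∀ y, ω y ≤ b}) ∧
      configAfter ω₀ ξ n ∈ {ω : Config K |
        ∃ y, 1 ≤ pos c s y ∧ pos c s y ≤ L ∧ 2 ≤ ω y}} ≤
      ENNReal.ofReal (D * Real.exp (-(n / D))) := by
  have hDpos : 0 < D := one_pos.trans_le hD1
  have hDinv : D⁻¹ ≤ 1 := inv_le_one_of_one_le₀ hD1
  refine (clockMeasure_killed_le K ω₀ _ _ (fun ω => (excess c s L ω : ℝ)) (r := 1 - D⁻¹)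
    (by linarith) (fun _ => Nat.cast_nonneg _) ?_ ?_ n).trans ?_
  · rintro ω ⟨y, h1, h2, h3⟩
    exact_mod_cast one_le_excess h1 h2 h3
  · rintro ω ⟨h0, h1, hb⟩
    have h2 := sum_excess_ring_le hL h0 h1
    have h3 := excess_le (c := c) (s := s) (L := L) hb
    set a := (activeSites c s L ω).card
    have h2' : (∑ m, (excess c s L (ring ω m) : ℝ)) + 2 * a ≤ 2 * K * excess c s L ω := by
      exact_mod_cast h2
    have h4 : (K : ℝ) * excess c s L ω ≤ a * D := by
      calc (K : ℝ) * excess c s L ω ≤ K * (a * (b * (L + 1) ^ 2) : ℕ) := by gcongr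
        _ = a * (K * (b * (L + 1) ^ 2) : ℕ) := by push_cast; ring
        _ ≤ a * D := by gcongr
    have h5 : D⁻¹ * (K * excess c s L ω) ≤ a := by
      rw [inv_mul_le_iff₀ hDpos, mul_comm D]; exact h4
    linarith
  · refine ENNReal.ofReal_le_ofReal ?_
    have h1 : (excess c s L ω₀ : ℝ) ≤ D := by
      refine le_trans ?_ hD
      have h2 : (activeSites c s L ω₀).card ≤ K := by
        simpa [ZMod.card] using Finset.card_le_univ (activeSites c s L ω₀)
      exact_mod_cast (excess_le hω₀).trans (Nat.mul_le_mul_right _ h2)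
    have h2 : (1 - D⁻¹) ^ n ≤ Real.exp (-(n / D)) := by
      calc (1 - D⁻¹) ^ n ≤ Real.exp (-D⁻¹) ^ n := by
            exact pow_le_pow_left₀ (by linarith) (Real.one_sub_le_exp_neg _) n
        _ = _ := by rw [← Real.exp_nat_mul]; congr 1; field_simp
    rw [mul_comm D]
    exact mul_le_mul h2 h1 (Nat.cast_nonneg _) (Real.exp_pos _).le

end Freezing

/-! ### Fluctuations of the centre of mass -/

section CentreOfMass

variable {K : ℕ} [NeZero K] {c : ZMod K} {s : ℤˣ}

/-- The sum of the coordinates of all particles. -/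
def moment (c : ZMod K) (s : ℤˣ) (ω : Config K) : ℕ := ∑ y, ω y * pos c s y

theorem moment_moveParticle {ω : Config K} {x v : ZMod K} (hx : 1 ≤ ω x) (hv : v ≠ x) :
    moment c s (moveParticle ω x v) + pos c s x = moment c s ω + pos c s v := by
  have hpt : ∀ y ∈ (Finset.univ : Finset (ZMod K)),
      moveParticle ω x v y * pos c s y + (if y = x then pos c s y else 0) =
        ω y * pos c s y + if y = v then pos c s y else 0 := by
    intro y _
    have h : moveParticle ω x v y + (if y = x then 1 else 0) = ω y + if y = v then 1 else 0 := by
      simp only [moveParticle]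
      split_ifs <;> subst_vars <;> first | omega | contradiction
    have h' := congrArg (· * pos c s y) h
    simpa only [add_mul, ite_mul, one_mul, zero_mul] using h'
  have h := Finset.sum_congr rfl hpt
  rw [Finset.sum_add_distrib, Finset.sum_add_distrib, Finset.sum_ite_eq', Finset.sum_ite_eq'] at h
  simpa [moment] using h

theorem cosh_le_one_add_sq {θ : ℝ} (h0 : 0 ≤ θ) (h1 : θ ≤ 1) : Real.cosh θ ≤ 1 + θ ^ 2 := by
  have h2 : θ ^ 2 ≤ 1 := pow_le_one₀ h0 h1
  have h3 := Real.abs_exp_sub_one_le (x := θ ^ 2 / 2) (by rw [abs_of_nonneg] <;> nlinarith)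
  rw [abs_of_nonneg (by positivity : 0 ≤ θ ^ 2 / 2)] at h3
  linarith [Real.cosh_le_exp_half_sq θ, le_abs_self (Real.exp (θ ^ 2 / 2) - 1)]

/-- As long as no particle visits the coordinates `0` and `K - 1`, the sum of the coordinates of
the particles is a martingale with increments in `{-1, 0, 1}`, which are nonzero with probability
at most `N / K`: it has Gaussian tails on the scale `√(n N / K)` after `n` rings. -/
theorem clockMeasure_moment_ge_le (N M : ℕ) {θ : ℝ} (hθ0 : 0 ≤ θ) (hθ1 : θ ≤ 1) (ω₀ : Config K)
    (n : ℕ) :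
    clockMeasure K {ξ | (∀ k < n, configAfter ω₀ ξ k ∈ {ω : Config K |
        (∀ y, ω y ≠ 0 → 1 ≤ pos c s y ∧ pos c s y + 1 < K) ∧ ∑ y, ω y = N}) ∧
      configAfter ω₀ ξ n ∈ {ω : Config K | M ≤ moment c s ω}} ≤
      ENNReal.ofReal (Real.exp (n * (N * θ ^ 2 / K) + θ * (moment c s ω₀ - M))) := by
  have hK : (0 : ℝ) < K := by exact_mod_cast Nat.pos_of_ne_zero (NeZero.ne K)
  set F : Config K → ℝ := fun ω => Real.exp (θ * (moment c s ω - M)) with hF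
  refine (clockMeasure_killed_le K ω₀ _ _ F (r := 1 + N * θ ^ 2 / K)
    (by positivity) (fun _ => (Real.exp_pos _).le) ?_ ?_ n).trans ?_
  · intro ω (hω : M ≤ moment c s ω)
    refine Real.one_le_exp (mul_nonneg hθ0 ?_)
    rw [sub_nonneg]
    exact_mod_cast hω
  · rintro ω ⟨hsupp, hN⟩
    have hx : ∀ x ∈ (Finset.univ : Finset (ZMod K)), ∑ δ, F (ring ω (x, δ)) ≤
        2 * F ω + 2 * θ ^ 2 * F ω * ω x := by
      intro x _
      have hF0 : 0 < F ω := Real.exp_pos _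
      rw [sum_sign s]
      by_cases h2 : 2 ≤ ω x
      · obtain ⟨hx1, hx2⟩ := hsupp x (by omega)
        have hs := pos_neighbour_same c s hx2
        have hn := pos_neighbour_neg c s hx1
        have h3 := moment_moveParticle (c := c) (s := s) (v := neighbour x s)
          (show 1 ≤ ω x by omega) (fun h => by rw [h] at hs; omega)
        have h4 := moment_moveParticle (c := c) (s := s) (v := neighbour x (-s))
          (show 1 ≤ ω x by omega) (fun h => by rw [h] at hn; omega)
        have h3' : moment c s (moveParticle ω x (neighbour x s)) = moment c s ω + 1 := by omega
        have h4' : moment c s (moveParticle ω x (neighbour x (-s))) + 1 = moment c s ω := by omega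
        have h4'' : (moment c s (moveParticle ω x (neighbour x (-s))) : ℝ) =
            moment c s ω - 1 := by rw [← h4']; push_cast; ring
        rw [ring_of_le (m := (x, s)) h2, ring_of_le (m := (x, -s)) h2]
        have e1 : F (moveParticle ω x (neighbour x s)) = F ω * Real.exp θ := by
          simp only [hF]
          rw [h3', ← Real.exp_add]; push_cast; ring_nf
        have e2 : F (moveParticle ω x (neighbour x (-s))) = F ω * Real.exp (-θ) := by
          simp only [hF]
          rw [h4'', ← Real.exp_add]; ring_nf
        simp only [e1, e2]
        have hc := cosh_le_one_add_sq hθ0 hθ1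
        rw [Real.cosh_eq] at hc
        have h5 : (1 : ℝ) ≤ ω x := by exact_mod_cast (show 1 ≤ ω x by omega)
        calc _ = F ω * (2 * ((Real.exp θ + Real.exp (-θ)) / 2)) := by ring
          _ ≤ F ω * (2 * (1 + θ ^ 2)) := by gcongr
          _ = 2 * F ω + 2 * θ ^ 2 * F ω * 1 := by ring
          _ ≤ _ := by gcongr
      · rw [ring_of_lt (m := (x, s)) (by simpa using h2), ring_of_lt (m := (x, -s))
          (by simpa using h2)]
        have : 0 ≤ 2 * θ ^ 2 * F ω * ω x := by positivity
        linarith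
    rw [Fintype.sum_prod_type]
    refine (Finset.sum_le_sum hx).trans (le_of_eq ?_)
    rw [Finset.sum_add_distrib, ← Finset.mul_sum, Finset.sum_const, Finset.card_univ, ZMod.card,
      ← Finset.mul_sum, ← Nat.cast_sum, hN, nsmul_eq_mul]
    field_simp
  · refine ENNReal.ofReal_le_ofReal ?_
    rw [Real.exp_add]
    gcongr
    rw [Real.exp_nat_mul]
    gcongr
    rw [add_comm]
    exact Real.add_one_le_exp _

end CentreOfMass

/-! ### A supercritical segment reaches its left end -/

section Supercritical

theorem card_mul_card_succ_le (T : Finset ℕ) (hT : ∀ t ∈ T, 1 ≤ t) :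
    T.card * (T.card + 1) ≤ 2 * ∑ t ∈ T, t := by
  induction T using Finset.induction_on_max with
  | empty => simp
  | insert a T ha ih =>
    have hna : a ∉ T := fun h => lt_irrefl _ (ha a h)
    rw [Finset.card_insert_of_notMem hna, Finset.sum_insert hna]
    have h1 := ih fun t ht => hT t (Finset.mem_insert_of_mem ht)
    have h2 : T.card + 1 ≤ a := by
      have h3 : T ⊆ Finset.Ico 1 a := fun t ht =>
        Finset.mem_Ico.2 ⟨hT t (Finset.mem_insert_of_mem ht), ha t ht⟩
      have h4 := Finset.card_le_card h3
      have h5 := hT a (Finset.mem_insert_self a T)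
      rw [Nat.card_Ico] at h4
      omega
    nlinarith

variable {K : ℕ} [NeZero K] {c : ZMod K} {s : ℤˣ}

/-- Particles that all sit at distinct positive coordinates have a large centre of mass. -/
theorem le_moment_of_le_one {ω : Config K} {N : ℕ} (h1 : ∀ y, ω y ≤ 1)
    (hpos : ∀ y, ω y ≠ 0 → 1 ≤ pos c s y) (hN : ∑ y, ω y = N) :
    N * (N + 1) / 2 ≤ moment c s ω := by
  set S : Finset (ZMod K) := {y | ω y ≠ 0} with hS
  have hω : ∀ y, ω y = if ω y ≠ 0 then 1 else 0 := fun y => by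
    have := h1 y
    split_ifs <;> omega
  have hcard : S.card = N := by
    rw [← hN, hS, Finset.card_filter]
    exact Finset.sum_congr rfl fun y _ => (hω y).symm
  have hmom : moment c s ω = ∑ t ∈ S.image (pos c s), t := by
    rw [Finset.sum_image (pos_injective c s).injOn, hS, Finset.sum_filter, moment]
    refine Finset.sum_congr rfl fun y _ => ?_
    have := h1 y
    split_ifs with h
    · rw [show ω y = 1 by omega, one_mul]
    · rw [not_not.1 h, zero_mul]
  have h := card_mul_card_succ_le (S.image (pos c s)) fun t ht => by
    obtain ⟨y, hy, rfl⟩ := Finset.mem_image.1 ht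
    exact hpos y (by simpa [hS] using hy)
  rw [Finset.card_image_of_injective _ (pos_injective c s), hcard, ← hmom] at h
  omega

/-- The configurations with `N` particles, all at positive coordinates, such that the sites
occupied beyond the coordinate `l` follow `l` without gap. -/
def spreadConfigs (c : ZMod K) (s : ℤˣ) (l N : ℕ) : Set (Config K) :=
  {ω | (∀ y, ω y ≠ 0 → 1 ≤ pos c s y) ∧
    (∀ y, ω y ≠ 0 → ∀ z, l < pos c s z → pos c s z ≤ pos c s y → ω z ≠ 0) ∧ ∑ y, ω y = N}

theorem pos_le_of_mem_spreadConfigs {ω : Config K} {l N : ℕ} (h : ω ∈ spreadConfigs c s l N)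
    {y : ZMod K} (hy : ω y ≠ 0) : pos c s y ≤ l + N := by
  obtain ⟨-, h2, h3⟩ := h
  have h4 : ∑ i ∈ Finset.Ioc l (pos c s y), 1 ≤ ∑ y, ω y :=
    calc ∑ i ∈ Finset.Ioc l (pos c s y), 1 ≤ ∑ i ∈ Finset.Ioc l (pos c s y), ω (site c s i) := by
          refine Finset.sum_le_sum fun i hi => ?_
          rw [Finset.mem_Ioc] at hi
          have hp := pos_site c s (hi.2.trans_lt (pos_lt c s y))
          exact Nat.one_le_iff_ne_zero.2 (h2 y hy _ (by omega) (by omega))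
      _ = ∑ y ∈ (Finset.Ioc l (pos c s y)).image (site c s), ω y := by
          rw [Finset.sum_image]
          intro i hi j hj hij
          rw [Finset.coe_Ioc, Set.mem_Ioc] at hi hj
          rw [← pos_site c s (hi.2.trans_lt (pos_lt c s y)),
            ← pos_site c s (hj.2.trans_lt (pos_lt c s y)), hij]
      _ ≤ _ := Finset.sum_le_sum_of_subset (Finset.subset_univ _)
  rw [Finset.sum_const, Nat.card_Ioc, smul_eq_mul, mul_one, h3] at h4
  omega

theorem ring_mem_spreadConfigs {ω : Config K} {l N : ℕ} (hK : l + N + 1 < K)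
    (h : ω ∈ spreadConfigs c s l N) (m : ZMod K × ℤˣ) (hm : ring ω m c = 0) :
    ring ω m ∈ spreadConfigs c s l N := by
  by_cases h2 : 2 ≤ ω m.1
  · have hx := h.1 m.1 (by omega)
    have hx' := pos_le_of_mem_spreadConfigs h (y := m.1) (by omega)
    have hle : ∀ z, ω z ≠ 0 → ring ω m z ≠ 0 := fun z hz =>
      Nat.one_le_iff_ne_zero.1 (ring_pos (Nat.one_le_iff_ne_zero.2 hz) m)
    have hnew : ∀ y, ring ω m y ≠ 0 → ω y = 0 → y = neighbour m.1 m.2 := by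
      intro y hy h0
      rw [ring_of_le h2, moveParticle] at hy
      split_ifs at hy with e1 e2
      · rw [e1] at h0; omega
      · exact e2
      · exact absurd h0 hy
    refine ⟨fun y hy => ?_, fun y hy z hz1 hz2 => ?_, ?_⟩
    · by_contra h0
      have : y = c := by rw [← site_pos c s y, show pos c s y = 0 by omega, site_zero]
      exact hy (this ▸ hm)
    · by_cases h0 : ω y = 0
      · obtain rfl := hnew y hy h0
        rcases pos_neighbour_cases c s hx (by omega) m.2 with h5 | h5
        · rcases Nat.lt_or_ge (pos c s m.1) (pos c s z) with h6 | h6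
          · rwa [pos_injective c s (show pos c s z = pos c s (neighbour m.1 m.2) by omega)]
          · exact hle z (h.2.1 m.1 (by omega) z hz1 h6)
        · exact hle z (h.2.1 m.1 (by omega) z hz1 (by omega))
      · exact hle z (h.2.1 y h0 z hz1 hz2)
    · rw [sum_ring (by omega)]
      exact h.2.2
  · rwa [ring_of_lt (by omega)]

theorem configAfter_mem_spreadConfigs {ω : Config K} {ξ : ℕ → ℝ × (ZMod K × ℤˣ)} {l N n : ℕ}
    (hK : l + N + 1 < K) (h : ω ∈ spreadConfigs c s l N) (hn : configAfter ω ξ n c = 0) :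
    configAfter ω ξ n ∈ spreadConfigs c s l N := by
  induction n with
  | zero => exact h
  | succ n ih => exact ring_mem_spreadConfigs hK (ih (configAfter_eq_zero n.le_succ hn)) _ hn

/-- If, in the initial configuration, one finds `N` particles in the segment `{1, …, l}`, with
centre of mass at most `l / 2`, then the site `0` is likely to be visited: otherwise the excess
particles all freeze within `n` rings, at sites whose mean coordinate is at least `(N + 1) / 2`, and
the martingale `moment` must have had a large fluctuation. -/
theorem clockMeasure_not_visited_le {l N b n : ℕ} {D θ : ℝ} (hK : l + N + 1 < K) (hD1 : 1 ≤ D)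
    (hD : (K * (b * (l + N + 1) ^ 2) : ℕ) ≤ D) (hθ0 : 0 ≤ θ) (hθ1 : θ ≤ 1) {η₀ ω₀ : Config K}
    (hη : η₀ ≤ ω₀) (hω₀ : ∀ y, ω₀ y ≤ b)
    (hsupp : ∀ y, η₀ y ≠ 0 → 1 ≤ pos c s y ∧ pos c s y ≤ l) (hN : ∑ y, η₀ y = N)
    (hmom : 2 * moment c s η₀ ≤ l * N) :
    clockMeasure K {ξ | (∀ k ≤ n, ∀ y, configAfter ω₀ ξ k y ≤ b) ∧ configAfter ω₀ ξ n c = 0} ≤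
      ENNReal.ofReal (D * Real.exp (-(n / D))) +
      ENNReal.ofReal (Real.exp (n * (N * θ ^ 2 / K) - θ * (N * (N + 1 - l) / 2))) := by
  have hη₀ : η₀ ∈ spreadConfigs c s l N := by
    refine ⟨fun y hy => (hsupp y hy).1, fun y hy z h1 h2 => ?_, hN⟩
    have := (hsupp y hy).2
    omega
  set M := N * (N + 1) / 2 with hM
  have h2M : 2 * M = N * (N + 1) := by
    rw [hM]; exact Nat.mul_div_cancel' (Nat.even_mul_succ_self N).two_dvd
  refine (measure_mono ?_).trans ((measure_union_le _ _).trans (add_le_add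
    (clockMeasure_active_le (c := c) (s := s) hK hD1 hD (ω₀ := η₀)
      (fun y => (hη y).trans (hω₀ y)) n)
    ((clockMeasure_moment_ge_le (c := c) (s := s) N M hθ0 hθ1 η₀ n).trans
      (ENNReal.ofReal_le_ofReal (Real.exp_le_exp.2 ?_)))))
  · rintro ξ ⟨hb, h0⟩
    have hle := fun k => configAfter_mono hη ξ k
    have hη0 : ∀ k ≤ n, configAfter η₀ ξ k c = 0 := fun k hk => by
      have h1 := configAfter_eq_zero hk h0
      have h2 := hle k c
      exact Nat.le_zero.1 (h1 ▸ h2)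
    have hspread := fun k hk => configAfter_mem_spreadConfigs (s := s) hK hη₀ (hη0 k hk)
    by_cases hact : ∃ y, 1 ≤ pos c s y ∧ pos c s y ≤ l + N ∧ 2 ≤ configAfter η₀ ξ n y
    · refine .inl ⟨fun k hk => ⟨?_, ?_, fun y => (hle k y).trans (hb k hk.le y)⟩, hact⟩
      · rw [site_zero]; exact hη0 k hk.le
      · by_contra h
        have := pos_le_of_mem_spreadConfigs (hspread k hk.le) h
        rw [pos_site c s hK] at this
        omega
    · push Not at hact
      refine .inr ⟨fun k hk => ⟨fun y hy => ?_, (hspread k hk.le).2.2⟩, ?_⟩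
      · have := pos_le_of_mem_spreadConfigs (hspread k hk.le) hy
        exact ⟨(hspread k hk.le).1 y hy, by omega⟩
      · refine le_moment_of_le_one (fun y => ?_) (hspread n le_rfl).1 (hspread n le_rfl).2.2
        by_cases hy : configAfter η₀ ξ n y = 0
        · omega
        · have := hact y ((hspread n le_rfl).1 y hy)
            (pos_le_of_mem_spreadConfigs (hspread n le_rfl) hy)
          omega
  · have h1 : 2 * (M : ℝ) = N * (N + 1) := by exact_mod_cast h2M
    have h2 : 2 * (moment c s η₀ : ℝ) ≤ l * N := by exact_mod_cast hmom
    have h3 : (moment c s η₀ : ℝ) - M ≤ -(N * (N + 1 - l) / 2) := by nlinarith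
    have h4 := mul_le_mul_of_nonneg_left h3 hθ0
    linarith

end Supercritical

/-! ### Two-phased configurations -/

section TwoPhased

variable {K : ℕ} [NeZero K]

theorem twoPhased_of_le_one_between {ω : Config K}
    (h : ∀ i j k : ℕ, i < j → j < k → k < K → ω i = 0 → ω k = 0 → ω j ≤ 1) :
    ω ∈ twoPhased K := by
  have hconn := isConnectedBlock_interval (0 : ZMod K)
  simp only [zero_add] at hconn
  set H : Finset ℕ := {i ∈ Finset.range K | ω i = 0} with hH
  have hmem : ∀ i, i ∈ H ↔ i < K ∧ ω i = 0 := by simp [hH]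
  have hval : ∀ z : ZMod K, ((z.val : ℕ) : ZMod K) = z := ZMod.natCast_zmod_val
  rcases H.eq_empty_or_nonempty with hE | hE
  · have hocc : ∀ z : ZMod K, 1 ≤ ω z := fun z => by
      by_contra h0
      have : z.val ∈ H := (hmem _).2 ⟨ZMod.val_lt z, by rw [hval]; omega⟩
      rw [hE] at this
      simp at this
    refine ⟨(fun k : ℕ => (k : ZMod K)) '' Set.Icc 0 (K - 1),
      (fun k : ℕ => (k : ZMod K)) '' Set.Icc 1 0, ?_, ?_, hconn _ _, hconn _ _,
      fun z _ => hocc z, ?_⟩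
    · simp
    · ext z
      simp only [Set.mem_union, Set.mem_univ, iff_true]
      exact .inl ⟨z.val, ⟨Nat.zero_le _, Nat.le_sub_one_of_lt (ZMod.val_lt z)⟩, hval z⟩
    · simp
  · -- `B` is the segment from the first to the last empty site.
    set i := H.min' hE
    set k := H.max' hE
    have hi := (hmem _).1 (H.min'_mem hE)
    have hk := (hmem _).1 (H.max'_mem hE)
    have hmin : ∀ z : ZMod K, ω z = 0 → i ≤ z.val := fun z hz =>
      H.min'_le _ ((hmem _).2 ⟨ZMod.val_lt z, by rwa [hval]⟩)
    have hmax : ∀ z : ZMod K, ω z = 0 → z.val ≤ k := fun z hz =>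
      H.le_max' _ ((hmem _).2 ⟨ZMod.val_lt z, by rwa [hval]⟩)
    have hB : (fun k : ℕ => (k : ZMod K)) '' Set.Icc i k = {z | i ≤ z.val ∧ z.val ≤ k} := by
      ext z
      constructor
      · rintro ⟨j, ⟨h1, h2⟩, rfl⟩
        have : ((j : ℕ) : ZMod K).val = j := ZMod.val_cast_of_lt (h2.trans_lt hk.1)
        exact ⟨by rw [this]; exact h1, by rw [this]; exact h2⟩
      · exact fun hz => ⟨z.val, hz, hval z⟩
    have hA : (fun k : ℕ => (k : ZMod K)) '' Set.Icc (k + 1) (K + i - 1) =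
        {z | i ≤ z.val ∧ z.val ≤ k}ᶜ := by
      ext z
      constructor
      · rintro ⟨j, ⟨h1, h2⟩, rfl⟩ ⟨h3, h4⟩
        simp only at h3 h4
        rcases Nat.lt_or_ge j K with h5 | h5
        · rw [ZMod.val_cast_of_lt h5] at h4
          omega
        · have h6 : ((j : ℕ) : ZMod K) = ((j - K : ℕ) : ZMod K) := by
            rw [Nat.cast_sub h5]; simp
          rw [h6, ZMod.val_cast_of_lt (by omega)] at h3
          omega
      · intro hz
        have hz' : ¬ (i ≤ z.val ∧ z.val ≤ k) := hz
        have hlt := ZMod.val_lt z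
        rcases Nat.lt_or_ge z.val i with h5 | h5
        · exact ⟨K + z.val, ⟨by omega, by omega⟩, by simp⟩
        · exact ⟨z.val, ⟨by omega, by omega⟩, hval z⟩
    refine ⟨_, _, ?_, ?_, hconn (k + 1) (K + i - 1), hconn i k, ?_, ?_⟩
    · rw [hA, hB]; exact disjoint_compl_left
    · rw [hA, hB]; exact Set.compl_union_self _
    · rw [hA]
      intro z hz
      by_contra h0
      exact hz ⟨hmin z (by omega), hmax z (by omega)⟩
    · rw [hB]
      rintro z ⟨h1, h2⟩
      rcases h1.eq_or_lt with h3 | h3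
      · rw [← hval z, ← h3, hi.2]; omega
      · rcases h2.eq_or_lt with h4 | h4
        · rw [← hval z, h4, hk.2]; omega
        · have := h i z.val k h3 h4 hk.1 hi.2 hk.2
          rwa [hval] at this

/-- Between two empty sites of coordinates `i < k` and around an active site, there are two
empty sites separated by occupied sites only. -/
theorem exists_nearest_empty {f : ℕ → ℕ} {i j k : ℕ} (hij : i < j) (hjk : j < k) (hi : f i = 0)
    (hk : f k = 0) (hj : f j ≠ 0) :
    ∃ i' k', i ≤ i' ∧ i' < j ∧ j < k' ∧ k' ≤ k ∧ f i' = 0 ∧ f k' = 0 ∧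
      ∀ m, i' < m → m < k' → f m ≠ 0 := by
  classical
  have hex : ∃ m, j < m ∧ f m = 0 := ⟨k, hjk, hk⟩
  have h1 := Nat.find_spec hex
  have h2 := fun m => Nat.find_min hex (m := m)
  have h3 := Nat.find_min' hex ⟨hjk, hk⟩
  set k' := Nat.find hex
  set i' := Nat.findGreatest (fun m => f m = 0) j with hi'
  have h4 : f i' = 0 := Nat.findGreatest_spec (P := fun m => f m = 0) hij.le hi
  have h5 : i ≤ i' := Nat.le_findGreatest hij.le hi
  have h6 : i' ≤ j := Nat.findGreatest_le _
  have h7 : i' ≠ j := fun h => hj (h ▸ h4)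
  refine ⟨i', k', h5, by omega, h1.1, h3, h4, h1.2, fun m hm hm' hfm => ?_⟩
  rcases Nat.lt_or_ge j m with h | h
  · exact h2 m hm' ⟨h, hfm⟩
  · exact Nat.findGreatest_is_greatest hm h hfm

end TwoPhased

/-! ### Typical configurations -/

section Typical

variable {K : ℕ} [NeZero K]

theorem sum_eq_sum_site (c : ZMod K) (s : ℤˣ) {l : ℕ} (hl : l < K) {f : ZMod K → ℕ}
    (hf : ∀ y, f y ≠ 0 → 1 ≤ pos c s y ∧ pos c s y ≤ l) :
    ∑ y, f y = ∑ i ∈ Finset.Icc 1 l, f (site c s i) := by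
  rw [← Finset.sum_image (s := Finset.Icc 1 l) (g := site c s) (f := f)]
  · refine (Finset.sum_subset (Finset.subset_univ _) fun y _ hy => ?_).symm
    by_contra h
    exact hy (Finset.mem_image.2 ⟨pos c s y, Finset.mem_Icc.2 (hf y h), site_pos c s y⟩)
  · intro i hi j hj hij
    rw [Finset.coe_Icc, Set.mem_Icc] at hi hj
    rw [← pos_site c s (hi.2.trans_lt hl), ← pos_site c s (hj.2.trans_lt hl), hij]

theorem card_segment (c : ZMod K) (s : ℤˣ) {L : ℕ} (hL : L < K) :
    ({y | 1 ≤ pos c s y ∧ pos c s y ≤ L} : Finset (ZMod K)).card = L := by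
  have h : ({y | 1 ≤ pos c s y ∧ pos c s y ≤ L} : Finset (ZMod K)) =
      (Finset.Icc 1 L).image (site c s) := by
    ext y
    simp only [Finset.mem_filter_univ, Finset.mem_image, Finset.mem_Icc]
    constructor
    · exact fun h => ⟨_, h, site_pos c s y⟩
    · rintro ⟨m, hm, rfl⟩
      rwa [pos_site c s (by omega)]
  rw [h, Finset.card_image_of_injOn, Nat.card_Icc, Nat.add_sub_cancel]
  intro a ha b hb hab
  rw [Finset.coe_Icc, Set.mem_Icc] at ha hb
  rw [← pos_site c s (show a < K by omega), ← pos_site c s (show b < K by omega), hab]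

/-- Around a site `x` of the supercritical phase, a typical configuration contains, on one side of
`x`, a supercritical segment whose centre of mass is closer to `x` than its middle. -/
theorem exists_le_of_typical {c : ℝ} {ω₀ ζ : Config K} {x : ZMod K} (hl : 10 * ell K < K)
    (hζ : ζ ∈ omegaPlus c K ∪ omegaMinus c K) (hle : ∀ y, ζ (y - x) ≤ ω₀ y) :
    ∃ s : ℤˣ, ∃ η₀ : Config K, η₀ ≤ ω₀ ∧
      (∀ y, η₀ y ≠ 0 → 1 ≤ pos x s y ∧ pos x s y ≤ 10 * ell K) ∧
      ∑ y, η₀ y = ⌊alphaK c K * ((10 * ell K : ℕ) : ℝ)⌋₊ ∧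
      2 * moment x s η₀ ≤ 10 * ell K * ⌊alphaK c K * ((10 * ell K : ℕ) : ℝ)⌋₊ := by
  obtain ⟨s, hs⟩ : ∃ s : ℤˣ, (fun z => ζ (((s : ℤ) : ZMod K) * z)) ∈ omegaPlus c K := by
    rcases hζ with h | h
    · exact ⟨1, by simpa using h⟩
    · exact ⟨-1, by simpa [omegaMinus] using h⟩
  obtain ⟨h1, h2, h3⟩ := hs
  set ζ' : Config K := fun z => ζ (((s : ℤ) : ZMod K) * z) with hζ'
  set η₀ : Config K := fun y => ζ (y - x) with hη₀
  have hη : ∀ y, η₀ y = ζ' (((s : ℤ) : ZMod K) * (y - x)) := fun y => by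
    simp only [hη₀, hζ', ← mul_assoc, sign_mul_self, one_mul]
  have hsite : ∀ i, η₀ (site x s i) = ζ' i := fun i => by
    rw [hη, site, add_sub_cancel_left, ← mul_assoc, sign_mul_self, one_mul]
  have hsupp : ∀ y, η₀ y ≠ 0 → 1 ≤ pos x s y ∧ pos x s y ≤ 10 * ell K := by
    intro y hy
    by_contra hn
    rw [hη] at hy
    refine hy (h3 _ fun i hi heq => hn ?_)
    rw [Finset.mem_Icc] at hi
    rwa [pos, heq, ZMod.val_cast_of_lt (hi.2.trans_lt hl)]
  refine ⟨s, η₀, hle, hsupp, ?_, ?_⟩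
  · rw [sum_eq_sum_site x s hl hsupp, ← h1]
    exact Finset.sum_congr rfl fun i _ => hsite i
  · rw [moment, sum_eq_sum_site x s hl (f := fun y => η₀ y * pos x s y)
      fun y hy => hsupp y (left_ne_zero_of_mul hy), ← h1]
    have h4 : ∀ i ∈ Finset.Icc 1 (10 * ell K), η₀ (site x s i) * pos x s (site x s i) =
        ζ' i * i := fun i hi => by
      rw [Finset.mem_Icc] at hi
      rw [hsite, pos_site x s (hi.2.trans_lt hl)]
    rw [Finset.sum_congr rfl h4]
    have h5 : (∑ i ∈ Finset.Icc 1 (10 * ell K), ((ζ' i : ℤ) * (i : ℤ))) ≤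
        5 * ell K * ∑ i ∈ Finset.Icc 1 (10 * ell K), (ζ' i : ℤ) := by
      rw [Finset.mul_sum, ← sub_nonpos, ← Finset.sum_sub_distrib]
      refine le_trans (le_of_eq (Finset.sum_congr rfl fun i _ => ?_)) h2
      ring
    zify
    linarith

variable {ρ : ℝ → ℝ} {uStar : ℝ}

/-- If a trajectory started from a typical configuration has occupied the supercritical phase but
is not two-phased after `n'` rings, then it has preserved an isolated segment of length less than
`ell K`, which contained an active site after any number `n ≤ n'` of rings. -/
theorem exists_active_segment {ω₀ : Config K} (hω₀ : ω₀ ∈ typical ρ uStar K) (hell : 1 ≤ ell K)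
    (hk : kStar ρ uStar K ≤ K) {ξ : ℕ → ℝ × (ZMod K × ℤˣ)} {n n' : ℕ} (hn : n ≤ n')
    (hA : ∀ x ∉ bulk ρ uStar K, configAfter ω₀ ξ n' x ≠ 0)
    (hT : configAfter ω₀ ξ n' ∉ twoPhased K) :
    ∃ c : ZMod K, ∃ L < ell K,
      (∀ k ≤ n, configAfter ω₀ ξ k (site c 1 0) = 0 ∧ configAfter ω₀ ξ k (site c 1 (L + 1)) = 0) ∧
      ∃ y, 1 ≤ pos c 1 y ∧ pos c 1 y ≤ L ∧ 2 ≤ configAfter ω₀ ξ n y := by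
  have hKpos : 0 < K := Nat.pos_of_ne_zero (NeZero.ne K)
  set ω := configAfter ω₀ ξ n' with hω
  obtain ⟨i₀, j, k₀, hij, hjk, hkK, hi₀, hk₀, hj⟩ : ∃ i j k : ℕ, i < j ∧ j < k ∧ k < K ∧
      ω i = 0 ∧ ω k = 0 ∧ 2 ≤ ω j := by
    by_contra hcon
    push Not at hcon
    exact hT (twoPhased_of_le_one_between fun i j k h1 h2 h3 h4 h5 =>
      Nat.le_of_lt_succ (hcon i j k h1 h2 h3 h4 h5))
  obtain ⟨i, k, hi', hi, hk1, hk2, hωi, hωk, hocc⟩ :=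
    exists_nearest_empty (f := fun m : ℕ => ω m) hij hjk hi₀ hk₀ (by omega)
  -- The empty sites belong to the bulk of the subcritical phase.
  have hbulk : ∀ m < K, ω m = 0 → ell K ≤ m ∧ m ≤ kStar ρ uStar K - ell K := by
    intro m hm hm0
    have h1 : (m : ZMod K) ∈ bulk ρ uStar K := by
      by_contra h
      exact hA _ h hm0
    obtain ⟨m', hm', h2⟩ := Finset.mem_image.1 h1
    rw [Finset.mem_Icc] at hm'
    have h3 := congrArg ZMod.val h2
    rw [ZMod.val_cast_of_lt (by omega), ZMod.val_cast_of_lt hm] at h3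
    omega
  have hib := hbulk i (by omega) hωi
  have hkb := hbulk k (by omega) hωk
  obtain ⟨L, rfl⟩ : ∃ L, k = i + (L + 1) := ⟨k - i - 1, by omega⟩
  set c : ZMod K := (i : ZMod K) with hc
  have hsite : ∀ m, site c 1 m = ((i + m : ℕ) : ZMod K) := fun m => by
    simp [site, hc]
  have h0 : ω (site c 1 0) = 0 := by rw [hsite]; exact hωi
  have h1 : ω (site c 1 (L + 1)) = 0 := by rw [hsite]; exact hωk
  have hjs : site c 1 (j - i) = (j : ZMod K) := by
    rw [hsite]; congr 1; omega
  have hjp : pos c 1 (j : ZMod K) = j - i := by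
    rw [← hjs, pos_site c 1 (by omega)]
  have hLK : L + 1 < K := by omega
  set S : Finset (ZMod K) := {y | 1 ≤ pos c 1 y ∧ pos c 1 y ≤ L} with hS
  have hScard : S.card = L := card_segment c 1 (by omega)
  have hjS : (j : ZMod K) ∈ S := by
    rw [hS, Finset.mem_filter_univ, hjp]; omega
  -- The segment has kept its particles, and is supercritical.
  have hmass : L + 1 ≤ segmentMass c 1 L ω₀ := by
    refine le_trans ?_ (segmentMass_configAfter_le (ξ := ξ) (n := n') h0 h1)
    rw [← hω, segmentMass]
    have h2 : ∑ y ∈ S, 1 < ∑ y ∈ S, ω y := by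
      refine Finset.sum_lt_sum (fun y hy => ?_) ⟨(j : ZMod K), hjS, by omega⟩
      rw [hS, Finset.mem_filter_univ] at hy
      have h3 := hocc (i + pos c 1 y) (by omega) (by omega)
      rw [← hsite, site_pos] at h3
      omega
    rw [Finset.sum_const, smul_eq_mul, mul_one, hScard] at h2
    exact h2
  have hLell : L < ell K := by
    by_contra! hge
    have hSeq : (S : Set (ZMod K)) = (fun m : ℕ => c + (m : ZMod K)) '' Set.Icc 1 L := by
      ext y
      simp only [hS, Finset.coe_filter, Finset.mem_univ, true_and, Set.mem_image, Set.mem_Icc]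
      constructor
      · intro h
        refine ⟨_, h, ?_⟩
        have := site_pos c 1 y
        simpa [site] using this
      · rintro ⟨m, hm, rfl⟩
        have := pos_site c 1 (show m < K by omega)
        simp only [site, Units.val_one, Int.cast_one, one_mul] at this
        rw [Set.mem_ofPred_eq, this]
        exact hm
    have hSb : S ⊆ bulk ρ uStar K := by
      intro y hy
      rw [hS, Finset.mem_filter_univ] at hy
      refine Finset.mem_image.2 ⟨i + pos c 1 y, Finset.mem_Icc.2 ⟨by omega, by omega⟩, ?_⟩
      rw [← hsite, site_pos]
    have hdens := hω₀.1 j (hSb hjS) S hSb hjS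
      (by rw [hSeq]; exact isConnectedBlock_interval c 1 L) (by rw [hScard]; exact hge)
    rw [density, hScard, one_div, inv_mul_le_iff₀ (by exact_mod_cast hell.trans hge), mul_one]
      at hdens
    have h2 : segmentMass c 1 L ω₀ ≤ L := by exact_mod_cast hdens
    omega
  refine ⟨c, L, hLell, fun k hk => ⟨configAfter_eq_zero (hk.trans hn) h0,
    configAfter_eq_zero (hk.trans hn) h1⟩, ?_⟩
  by_contra hcon
  push Not at hcon
  have h2 := frozen_configAfter hn h0 h1
    (fun y hy hy' => Nat.le_of_lt_succ (hcon y hy hy')) (j : ZMod K) (by omega) (by omega)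
  rw [← hω] at h2
  omega

end Typical

/-! ### Quantitative estimate at fixed size -/

section FixedSize

variable {K : ℕ} [NeZero K] {ρ : ℝ → ℝ} {uStar : ℝ}

/-- A bounded path which is not two-phased at the final time corresponds to a chain of
configurations with bounded occupation numbers which is not two-phased after some number `n'` of
rings, and `n ≤ n'` unless the `n`-th ring is late. -/
theorem ae_of_zrPath_mem (ω₀ : Config K) {b : ℕ} (hb : Real.log K ^ 2 ≤ b) (n : ℕ) :
    ∀ᵐ ξ ∂(clockMeasure K),
      zrPath ω₀ ξ ∈ boundedPaths K ∩ {w | w (finalTime K) ∉ twoPhased K} →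
      (∀ y, ω₀ y ≤ b) ∧ (finalTime K < ∑ i ∈ Finset.range n, (ξ i).1 ∨
        ∃ n' ≥ n, (∀ k ≤ n', ∀ y, configAfter ω₀ ξ k y ≤ b) ∧
          configAfter ω₀ ξ n' ∉ twoPhased K) := by
  have hT : 0 ≤ finalTime K := Real.rpow_nonneg (Nat.cast_nonneg K) _
  filter_upwards [ae_waitingTime_pos K, ae_exists_late K (finalTime K)] with ξ hpos hlate
  rintro ⟨hbdd, htwo⟩
  have hle : ∀ k ≤ ringCount ξ (finalTime K), ∀ y, configAfter ω₀ ξ k y ≤ b := by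
    intro k hk y
    obtain ⟨t, ht0, ht1, htk⟩ := exists_time_of_le_ringCount hT hpos hlate hk
    have h := hbdd y t ht0 ht1
    rw [zrPath, htk] at h
    exact_mod_cast h.le.trans hb
  refine ⟨hle 0 (Nat.zero_le _), ?_⟩
  rcases lt_or_ge (finalTime K) (∑ i ∈ Finset.range n, (ξ i).1) with h | h
  · exact .inl h
  · exact .inr ⟨_, le_ringCount hpos hlate h, hle, htwo⟩

/-- The union bound: either the `n`-th ring is late, or a site outside the bulk is still empty after
`n` rings, or one of the segments of length less than `ell K` is isolated but not frozen. -/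
theorem zrProb_le {ω₀ : Config K} (hω₀ : ω₀ ∈ typical ρ uStar K) (hell : 1 ≤ ell K)
    (hk : kStar ρ uStar K ≤ K) {N b n : ℕ} {D θ : ℝ}
    (hN : N = ⌊alphaK (cStar ρ uStar) K * ((10 * ell K : ℕ) : ℝ)⌋₊) (hN20 : N ≤ 20 * ell K)
    (hellK : 30 * ell K + 1 < K) (hb : Real.log K ^ 2 ≤ b) (hD1 : 1 ≤ D)
    (hD : (K * (b * (30 * ell K + 1) ^ 2) : ℕ) ≤ D) (hθ0 : 0 ≤ θ) (hθ1 : θ ≤ 1) :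
    zrProb K ω₀ (boundedPaths K ∩ {w | w (finalTime K) ∉ twoPhased K}) ≤
      ENNReal.ofReal (n / (2 * K * finalTime K)) +
      (K * (ENNReal.ofReal (D * Real.exp (-(n / D))) +
        ENNReal.ofReal (Real.exp (n * (N * θ ^ 2 / K) - θ * (N * (N + 1 - (10 * ell K : ℕ)) / 2)))) +
      K * (ell K * ENNReal.ofReal (D * Real.exp (-(n / D))))) := by
  have hKpos : (0 : ℝ) < K := by exact_mod_cast Nat.pos_of_ne_zero (NeZero.ne K)
  have hae := ae_of_zrPath_mem ω₀ hb n
  by_cases hb₀ : ∀ y, ω₀ y ≤ b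
  swap
  · refine le_trans (le_of_eq ?_) bot_le
    refine measure_mono_null_ae ?_ (measure_empty (μ := clockMeasure K))
    filter_upwards [hae] with ξ hξ hmem
    exact hb₀ (hξ hmem).1
  have hsub : {ξ | zrPath ω₀ ξ ∈ boundedPaths K ∩ {w | w (finalTime K) ∉ twoPhased K}}
      ≤ᵐ[clockMeasure K]
      ({ξ | finalTime K < ∑ i ∈ Finset.range n, (ξ i).1} ∪
      ((⋃ x : ZMod K, {ξ | x ∉ bulk ρ uStar K ∧
        (∀ k ≤ n, ∀ y, configAfter ω₀ ξ k y ≤ b) ∧ configAfter ω₀ ξ n x = 0}) ∪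
      ⋃ c : ZMod K, ⋃ L ∈ Finset.range (ell K), {ξ | (∀ k < n, configAfter ω₀ ξ k ∈
          {ω : Config K | ω (site c 1 0) = 0 ∧ ω (site c 1 (L + 1)) = 0 ∧ ∀ y, ω y ≤ b}) ∧
        configAfter ω₀ ξ n ∈ {ω : Config K |
          ∃ y, 1 ≤ pos c 1 y ∧ pos c 1 y ≤ L ∧ 2 ≤ ω y}}) :
        Set (ℕ → ℝ × (ZMod K × ℤˣ))) := by
    filter_upwards [hae] with ξ hξ hmem
    rcases (hξ hmem).2 with h | ⟨n', hn', hle, htwo⟩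
    · exact .inl h
    · right
      by_cases hA : ∀ x ∉ bulk ρ uStar K, configAfter ω₀ ξ n' x ≠ 0
      · right
        obtain ⟨c, L, hL, h1, h2⟩ := exists_active_segment hω₀ hell hk hn' hA htwo
        exact Set.mem_iUnion.2 ⟨c, Set.mem_iUnion₂.2 ⟨L, Finset.mem_range.2 hL,
          fun k hk => ⟨(h1 k hk.le).1, (h1 k hk.le).2, hle k (hk.le.trans hn')⟩, h2⟩⟩
      · left
        push Not at hA
        obtain ⟨x, hx, hx0⟩ := hA
        exact Set.mem_iUnion.2 ⟨x, hx, fun k hk => hle k (hk.trans hn'),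
          configAfter_eq_zero hn' hx0⟩
  refine (measure_mono_ae hsub).trans ((measure_union_le _ _).trans (add_le_add
    (clockMeasure_late_le K n (Real.rpow_pos_of_pos hKpos _))
    ((measure_union_le _ _).trans (add_le_add ?_ ?_))))
  · refine (measure_iUnion_fintype_le _ _).trans ((Finset.sum_le_card_nsmul _ _ _ ?_).trans
      (le_of_eq (by rw [Finset.card_univ, ZMod.card, nsmul_eq_mul])))
    intro x _
    by_cases hx : x ∈ bulk ρ uStar K
    · simp [hx]
    · obtain ⟨ζ, hζ, hle⟩ := hω₀.2 x hx
      obtain ⟨s, η₀, h1, h2, h3, h4⟩ := exists_le_of_typical (by omega) hζ hle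
      rw [← hN] at h3 h4
      refine (measure_mono fun ξ hξ => hξ.2).trans
        (clockMeasure_not_visited_le (s := s) (l := 10 * ell K) (by omega) hD1 ?_ hθ0 hθ1 h1 hb₀
          h2 h3 h4)
      refine le_trans ?_ hD
      have : 10 * ell K + N + 1 ≤ 30 * ell K + 1 := by omega
      gcongr
  · refine (measure_iUnion_fintype_le _ _).trans ((Finset.sum_le_card_nsmul _ _ _ ?_).trans
      (le_of_eq (by rw [Finset.card_univ, ZMod.card, nsmul_eq_mul])))
    intro c _
    refine (measure_biUnion_finset_le _ _).trans ((Finset.sum_le_card_nsmul _ _ _ ?_).trans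
      (le_of_eq (by rw [Finset.card_range, nsmul_eq_mul])))
    intro L hL
    rw [Finset.mem_range] at hL
    refine clockMeasure_active_le (by omega) hD1 ?_ hb₀ n
    refine le_trans ?_ hD
    have : L + 1 ≤ 30 * ell K + 1 := by omega
    gcongr

end FixedSize

/-! ### Constants of the macroscopic profile -/

section Profile

variable {ρ : ℝ → ℝ} {uStar : ℝ}

theorem IsProfile.intervalIntegrable (hρ : IsProfile ρ uStar) (a b : ℝ) :
    IntervalIntegrable (fun s => 1 - ρ s) volume a b :=
  (continuous_const.sub hρ.contDiff.continuous).intervalIntegrable a b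

theorem IsProfile.vMap_one_pos (hρ : IsProfile ρ uStar) : 0 < vMap ρ 1 :=
  intervalIntegral.intervalIntegral_pos_of_pos (hρ.intervalIntegrable 0 1)
    (fun s => by linarith [hρ.lt_one s]) one_pos

theorem IsProfile.vMap_uStar_le (hρ : IsProfile ρ uStar) : vMap ρ uStar ≤ vMap ρ 1 := by
  have h := intervalIntegral.integral_add_adjacent_intervals
    (hρ.intervalIntegrable 0 uStar) (hρ.intervalIntegrable uStar 1)
  have h1 : 0 ≤ ∫ s in uStar..1, (1 - ρ s) :=
    intervalIntegral.integral_nonneg hρ.uStar_mem.2.le fun s _ => by linarith [hρ.lt_one s]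
  unfold vMap
  linarith

theorem IsProfile.kStar_le (hρ : IsProfile ρ uStar) (K : ℕ) : kStar ρ uStar K ≤ K := by
  refine Nat.floor_le_of_le ?_
  rw [div_le_iff₀ hρ.vMap_one_pos]
  exact mul_le_mul_of_nonneg_left hρ.vMap_uStar_le (Nat.cast_nonneg K)

theorem IsProfile.cStar_pos (hρ : IsProfile ρ uStar) : 0 < cStar ρ uStar := by
  have hu := hρ.uStar_mem
  have hcrit : ∀ u, (u = 0 ∨ u = uStar) → ρ u = 1 / 2 := by
    intro u h
    have : u ∈ {u ∈ Set.Ico (0 : ℝ) 1 | ρ u = 1 / 2} := by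
      rw [hρ.critical]; exact h
    exact this.2
  have hsub : ∀ u ∈ Set.Icc 0 uStar, ρ u ≤ 1 / 2 := by
    intro u h
    rw [← hρ.subcritical] at h
    exact h.2
  have hdiff : ∀ u, HasDerivAt ρ (deriv ρ u) u := fun u =>
    (hρ.contDiff.differentiable (by norm_num) u).hasDerivAt
  -- `ρ ≤ 1/2` on `[0, u_*]` forces the signs of the derivatives at the ends.
  have h0 : deriv ρ 0 ≤ 0 := by
    have ht := (hdiff 0).hasDerivWithinAt (s := Set.Ioi 0)
    rw [hasDerivWithinAt_iff_tendsto_slope' (by simp)] at ht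
    refine le_of_tendsto ht ?_
    filter_upwards [Ioo_mem_nhdsGT hu.1] with u hu'
    rw [slope_def_field, hcrit 0 (.inl rfl)]
    exact div_nonpos_of_nonpos_of_nonneg
      (by linarith [hsub u ⟨hu'.1.le, hu'.2.le⟩]) (by linarith [hu'.1])
  have h1 : 0 ≤ deriv ρ uStar := by
    have ht := (hdiff uStar).hasDerivWithinAt (s := Set.Iio uStar)
    rw [hasDerivWithinAt_iff_tendsto_slope' (by simp)] at ht
    refine ge_of_tendsto ht ?_
    filter_upwards [Ioo_mem_nhdsLT hu.1] with u hu'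
    rw [slope_def_field, hcrit uStar (.inr rfl)]
    exact div_nonneg_of_nonpos
      (by linarith [hsub u ⟨hu'.1.le, hu'.2.le⟩]) (by linarith [hu'.2])
  have h0' := lt_of_le_of_ne h0 (hρ.deriv_ne_zero 0 (hcrit 0 (.inl rfl)))
  have h1' := lt_of_le_of_ne h1 (hρ.deriv_ne_zero uStar (hcrit uStar (.inr rfl))).symm
  have := hρ.vMap_one_pos
  exact mul_pos (by positivity) (lt_min (by linarith) h1')

end Profile

/-! ### Asymptotics -/

section Asymptotics

/-- The upper bound on the probability in terms of `y = K ^ (1 / 32)`. -/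
def errorBound (c y : ℝ) : ℝ :=
  (y ^ 4)⁻¹ + (y ^ 32 * (y ^ 81 * Real.exp (-y) + Real.exp 40 * Real.exp (-(c * y))) +
    y ^ 64 * (y ^ 81 * Real.exp (-y)))

theorem tendsto_errorBound {c : ℝ} (hc : 0 < c) : Tendsto (errorBound c) atTop (𝓝 0) := by
  have h1 : Tendsto (fun y : ℝ => (y ^ 4)⁻¹) atTop (𝓝 0) :=
    (tendsto_pow_atTop (by norm_num)).inv_tendsto_atTop
  have h2 := Real.tendsto_pow_mul_exp_neg_atTop_nhds_zero 113
  have h3 := Real.tendsto_pow_mul_exp_neg_atTop_nhds_zero 145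
  have h4 : Tendsto (fun y : ℝ => Real.exp 40 * (y ^ 32 * Real.exp (-(c * y)))) atTop (𝓝 0) := by
    have := (tendsto_rpow_mul_exp_neg_mul_atTop_nhds_zero 32 c hc).const_mul (Real.exp 40)
    rw [mul_zero] at this
    refine this.congr fun y => ?_
    rw [neg_mul, show (32 : ℝ) = (32 : ℕ) by norm_num, Real.rpow_natCast]
  have h := ((h1.add h2).add h4).add h3
  simp only [add_zero] at h
  refine h.congr fun y => ?_
  unfold errorBound
  ring

/-- Here `n ≈ y ^ 84 = K ^ (21 / 8)`, `D = y ^ 81` exceeds the relaxation time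
`K log² K ℓ_K ^ 2 ≈ y ^ 80 log² K` of the segments, and `θ = y ^ (-38)` keeps the quadratic term
`n N θ ^ 2 / K` bounded while `θ N (N + 1 - 10 ℓ_K)` is of order `y ^ 2`. -/
theorem zrProb_le_errorBound {ρ : ℝ → ℝ} {uStar : ℝ} (hρ : IsProfile ρ uStar) {K : ℕ} [NeZero K]
    {y : ℝ} (hy2 : 2 ≤ y) (hyK : y ^ 32 = K) (hyc : cStar ρ uStar ≤ y)
    (hylog : 961 * (Real.log K ^ 2 + 1) ≤ y) {ω₀ : Config K} (hω₀ : ω₀ ∈ typical ρ uStar K) :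
    zrProb K ω₀ (boundedPaths K ∩ {w | w (finalTime K) ∉ twoPhased K}) ≤
      ENNReal.ofReal (errorBound (cStar ρ uStar) y) := by
  have hc := hρ.cStar_pos
  set c := cStar ρ uStar with hcdef
  have hy0 : 0 < y := by linarith
  have hy1 : 1 ≤ y := by linarith
  have hK0 : (0 : ℝ) < K := by rw [← hyK]; positivity
  have hpow : ∀ (m : ℕ) (q : ℝ), q = m / 32 → (K : ℝ) ^ q = y ^ m := by
    intro m q hq
    rw [← hyK, ← Real.rpow_natCast, ← Real.rpow_mul hy0.le, hq, ← Real.rpow_natCast]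
    congr 1
    push_cast
    ring
  have hT : finalTime K = y ^ 56 := hpow 56 _ (by norm_num)
  have h34 : (K : ℝ) ^ (3 / 4 : ℝ) = y ^ 24 := hpow 24 _ (by norm_num)
  have hy24 : (2 : ℝ) ≤ y ^ 24 := hy2.trans (le_self_pow₀ hy1 (by norm_num))
  have hy8 : (256 : ℝ) ≤ y ^ 8 := by
    calc (256 : ℝ) = 2 ^ 8 := by norm_num
      _ ≤ y ^ 8 := by gcongr
  -- The mesoscopic scale `ℓ` is comparable to `y ^ 24`.
  have hlu : (ell K : ℝ) ≤ y ^ 24 := by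
    rw [← h34]; exact Nat.floor_le (Real.rpow_nonneg hK0.le _)
  have hll : y ^ 24 / 2 ≤ ell K := by
    have := Nat.sub_one_lt_floor ((K : ℝ) ^ (3 / 4 : ℝ))
    rw [h34] at this
    have h2 : (ell K : ℝ) = (⌊y ^ 24⌋₊ : ℝ) := by rw [ell, h34]
    rw [h2]
    linarith
  set ℓ := ell K with hℓ
  have hell1 : 1 ≤ ℓ := by
    have : (1 : ℝ) ≤ ℓ := by linarith
    exact_mod_cast this
  have hell1' : (1 : ℝ) ≤ ℓ := by exact_mod_cast hell1
  have hy32 : y ^ 32 = y ^ 24 * y ^ 8 := by ring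
  have hellK : 30 * ℓ + 1 < K := by
    have : (30 * ℓ + 1 : ℝ) < K := by
      rw [← hyK, hy32]
      nlinarith
    exact_mod_cast this
  have hellK' : (ℓ : ℝ) ≤ y ^ 32 := by
    rw [hyK]
    have : ℓ ≤ K := by omega
    exact_mod_cast this
  -- The number of particles of the supercritical segments.
  set N := ⌊alphaK c K * ((10 * ℓ : ℕ) : ℝ)⌋₊ with hN
  have hα : alphaK c K = 1 + c * ℓ / y ^ 32 := by rw [alphaK, hyK]
  have hα0 : 0 ≤ c * ℓ / y ^ 32 := by positivity
  have hα1 : c * ℓ / y ^ 32 ≤ 1 := by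
    rw [div_le_one (by positivity), hy32, mul_comm c]
    refine mul_le_mul hlu (hyc.trans (le_self_pow₀ hy1 (by norm_num))) hc.le (by positivity)
  have hN20 : N ≤ 20 * ℓ := by
    refine Nat.floor_le_of_le ?_
    rw [hα]; push_cast
    nlinarith
  have hN10 : 10 * ℓ ≤ N := by
    refine Nat.le_floor ?_
    rw [hα]
    nlinarith [(Nat.cast_nonneg (10 * ℓ) : (0 : ℝ) ≤ ((10 * ℓ : ℕ) : ℝ))]
  have hNexc : 10 * c * ℓ ^ 2 / y ^ 32 ≤ (N : ℝ) + 1 - (10 * ℓ : ℕ) := by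
    have h := Nat.lt_floor_add_one (alphaK c K * ((10 * ℓ : ℕ) : ℝ))
    rw [← hN, hα] at h
    have h2 : (1 + c * ℓ / y ^ 32) * ((10 * ℓ : ℕ) : ℝ) =
        (10 * ℓ : ℕ) + 10 * c * ℓ ^ 2 / y ^ 32 := by push_cast; ring
    linarith
  have hN20' : (N : ℝ) ≤ 20 * y ^ 24 := by
    have : (N : ℝ) ≤ 20 * ℓ := by exact_mod_cast hN20
    linarith
  have hN10' : (10 * ℓ : ℝ) ≤ N := by exact_mod_cast hN10
  -- The number of rings.
  set n := ⌈y ^ 84⌉₊ with hn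
  have hnl : y ^ 84 ≤ n := Nat.le_ceil _
  have hnu : (n : ℝ) ≤ 2 * y ^ 84 := by
    have h := Nat.ceil_lt_add_one (show 0 ≤ y ^ 84 by positivity)
    have h1 : 1 ≤ y ^ 84 := one_le_pow₀ hy1
    linarith
  set b := ⌈Real.log K ^ 2⌉₊ with hb
  have hbu : 961 * (b : ℝ) ≤ y := by
    have h := Nat.ceil_lt_add_one (show 0 ≤ Real.log K ^ 2 by positivity)
    linarith
  have hD : ((K * (b * (30 * ℓ + 1) ^ 2) : ℕ) : ℝ) ≤ y ^ 81 := by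
    push_cast
    rw [← hyK]
    have h1 : (30 * ℓ + 1 : ℝ) ≤ 31 * y ^ 24 := by linarith
    calc y ^ 32 * (b * (30 * ℓ + 1 : ℝ) ^ 2) ≤ y ^ 32 * (b * (31 * y ^ 24) ^ 2) := by gcongr
      _ = y ^ 80 * (961 * b) := by ring
      _ ≤ y ^ 80 * y := by gcongr
      _ = y ^ 81 := by ring
  have hmain := zrProb_le hω₀ hell1 (hρ.kStar_le K) (n := n) (θ := (y ^ 38)⁻¹) hN hN20 hellK
    (Nat.le_ceil (Real.log K ^ 2)) (one_le_pow₀ hy1) hD (by positivity)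
    (inv_le_one_of_one_le₀ (one_le_pow₀ hy1))
  have hE1 : y ^ 81 * Real.exp (-(n / y ^ 81)) ≤ y ^ 81 * Real.exp (-y) := by
    gcongr
    rw [le_div_iff₀ (by positivity)]
    calc y * y ^ 81 = y ^ 82 := by ring
      _ ≤ y ^ 84 := pow_le_pow_right₀ hy1 (by norm_num)
      _ ≤ n := hnl
  have hE2 : Real.exp (n * (N * (y ^ 38)⁻¹ ^ 2 / K) -
      (y ^ 38)⁻¹ * (N * (N + 1 - (10 * ℓ : ℕ)) / 2)) ≤ Real.exp 40 * Real.exp (-(c * y)) := by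
    rw [← Real.exp_add, Real.exp_le_exp, ← hyK]
    have h1 : n * (N * (y ^ 38)⁻¹ ^ 2 / y ^ 32) ≤ 40 := by
      calc n * (N * (y ^ 38)⁻¹ ^ 2 / y ^ 32)
          ≤ (2 * y ^ 84) * ((20 * y ^ 24) * (y ^ 38)⁻¹ ^ 2 / y ^ 32) := by gcongr
        _ = 40 := by field_simp; ring
    have h2 : c * y ≤ (y ^ 38)⁻¹ * (N * (N + 1 - (10 * ℓ : ℕ)) / 2) := by
      calc c * y ≤ c * y ^ 2 := by gcongr; exact le_self_pow₀ hy1 (by norm_num)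
        _ ≤ (y ^ 38)⁻¹ * ((10 * (y ^ 24 / 2)) * (10 * c * (y ^ 24 / 2) ^ 2 / y ^ 32) / 2) := by
            have : (y ^ 38)⁻¹ * ((10 * (y ^ 24 / 2)) * (10 * c * (y ^ 24 / 2) ^ 2 / y ^ 32) / 2) =
                50 / 8 * (c * y ^ 2) := by field_simp; ring
            rw [this]
            have : 0 ≤ c * y ^ 2 := by positivity
            linarith
        _ ≤ (y ^ 38)⁻¹ * ((10 * ℓ) * (10 * c * ℓ ^ 2 / y ^ 32) / 2) := by gcongr
        _ ≤ _ := by gcongr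
    linarith
  have hlate : (n : ℝ) / (2 * K * finalTime K) ≤ (y ^ 4)⁻¹ := by
    rw [hT, ← hyK, div_le_iff₀ (by positivity)]
    refine hnu.trans (le_of_eq ?_)
    field_simp
  refine hmain.trans ?_
  have hE0 : 0 ≤ y ^ 81 * Real.exp (-y) := by positivity
  have hE0' : 0 ≤ Real.exp 40 * Real.exp (-(c * y)) := by positivity
  have hKE : (K : ℝ≥0∞) = ENNReal.ofReal (y ^ 32) := by rw [hyK, ENNReal.ofReal_natCast]
  have hℓE : (ℓ : ℝ≥0∞) ≤ ENNReal.ofReal (y ^ 32) := by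
    rw [← ENNReal.ofReal_natCast]; exact ENNReal.ofReal_le_ofReal hellK'
  have hsplit : ∀ A B : ℝ, 0 ≤ A → 0 ≤ B →
      ENNReal.ofReal ((y ^ 4)⁻¹ + (y ^ 32 * (A + B) + y ^ 64 * A)) =
        ENNReal.ofReal (y ^ 4)⁻¹ + (ENNReal.ofReal (y ^ 32) * (ENNReal.ofReal A + ENNReal.ofReal B)
          + ENNReal.ofReal (y ^ 32) * (ENNReal.ofReal (y ^ 32) * ENNReal.ofReal A)) := by
    intro A B hA hB
    have hp : 0 ≤ y ^ 32 := by positivity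
    have h4 : 0 ≤ (y ^ 4)⁻¹ := by positivity
    have h1 : 0 ≤ y ^ 32 * (A + B) := mul_nonneg hp (add_nonneg hA hB)
    have h2 : 0 ≤ y ^ 32 * (y ^ 32 * A) := mul_nonneg hp (mul_nonneg hp hA)
    rw [show y ^ 64 * A = y ^ 32 * (y ^ 32 * A) by ring, ENNReal.ofReal_add h4 (add_nonneg h1 h2),
      ENNReal.ofReal_add h1 h2, ENNReal.ofReal_mul hp, ENNReal.ofReal_add hA hB,
      ENNReal.ofReal_mul hp, ENNReal.ofReal_mul hp]
  rw [errorBound, hsplit _ _ hE0 hE0', hKE]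
  gcongr

theorem tendsto_pnat_cast : Tendsto (fun K : ℕ+ => ((K : ℕ) : ℝ)) atTop atTop :=
  tendsto_natCast_atTop_atTop.comp tendsto_PNat_val_atTop_atTop

end Asymptotics

end FacilitatedZR

end

theorem proposition4p4 (ρ : ℝ → ℝ) (uStar : ℝ) (hρ : FacilitatedZR.IsProfile ρ uStar) :
    Tendsto
      (fun K : ℕ+ =>
        ⨆ ω₀ ∈ FacilitatedZR.typical ρ uStar (K : ℕ),
          FacilitatedZR.zrProb (K : ℕ) ω₀
            (FacilitatedZR.boundedPaths (K : ℕ) ∩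
              {w | w (FacilitatedZR.finalTime (K : ℕ)) ∉ FacilitatedZR.twoPhased (K : ℕ)}))
      atTop (𝓝 0) := by
  have hcast := FacilitatedZR.tendsto_pnat_cast
  have hy : Tendsto (fun K : ℕ+ => ((K : ℕ) : ℝ) ^ (1 / 32 : ℝ)) atTop atTop :=
    (tendsto_rpow_atTop (by norm_num)).comp hcast
  have hlog : ∀ᶠ x : ℝ in atTop, 961 * (Real.log x ^ 2 + 1) ≤ x ^ (1 / 32 : ℝ) := by
    have h1 := (isLittleO_log_rpow_rpow_atTop 2 (show (0 : ℝ) < 1 / 32 by norm_num)).bound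
      (show (0 : ℝ) < 1 / 1922 by norm_num)
    have h2 := (tendsto_rpow_atTop (show (0 : ℝ) < 1 / 32 by norm_num)).eventually_ge_atTop 1922
    filter_upwards [h1, h2] with x h1 h2
    rw [Real.rpow_two, Real.norm_of_nonneg (by positivity),
      Real.norm_of_nonneg (by linarith)] at h1
    linarith
  have hlim := (ENNReal.tendsto_ofReal
    ((FacilitatedZR.tendsto_errorBound hρ.cStar_pos).comp hy))
  rw [ENNReal.ofReal_zero] at hlim
  refine tendsto_of_tendsto_of_tendsto_of_le_of_le' tendsto_const_nhds hlim
    (Eventually.of_forall fun _ => bot_le) ?_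
  filter_upwards [hy.eventually_ge_atTop 2,
    hy.eventually_ge_atTop (FacilitatedZR.cStar ρ uStar), hcast.eventually hlog]
    with K h1 h2 h3
  refine iSup₂_le fun ω₀ hω₀ => ?_
  refine FacilitatedZR.zrProb_le_errorBound hρ h1 ?_ h2 h3 hω₀
  rw [← Real.rpow_natCast, ← Real.rpow_mul (Nat.cast_nonneg _)]
  norm_num
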